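/- Let $\mathcal X\subset\mathbb R$ be bounded and let $\mathbf X=\{X_i\}_{i\ge 1}$ be a stationary $\mathcal X$-valued process that is $\Psi^*$-mixing: with $\mathcal F_1^{j}=\sigma(X_1,\dots,X_j)$ and $\mathcal F_{j}^{\infty}=\sigma(X_j,X_{j+1},\dots)$, $$\psi^*(g)=\sup\Big\{\tfrac{P(\mathcal A\cap\mathcal B)}{P(\mathcal A)P(\mathcal B)}:\ j\ge 1,\ \mathcal A\in\mathcal F_1^{j},\ \mathcal B\in\mathcal F_{j+g}^\infty,\ P(\mathcal A)P(\mathcal B)>0\Big\}\to 1\quad (g\to\infty).$$ All logarithms, entropies and divergences are in base $2$. For $x\in\mathbb R$ let $[x]_b=\lfloor 2^b x\rfloor/2^b$ be its $b$-bit quantization, applied coordinatewise to vectors, and $\mathcal X_b=\{[x]_b:x\in\mathcal X\}$. Let $$\bar d_o(\mathbf X)=\lim_{k\to\infty}\ \limsup_{b\to\infty}\ \frac1b H\big([X_{k+1}]_b\,\big|\,[X_1]_b,\dots,[X_k]_b\big)$$ be the upper information dimension. For $u^n\in\mathcal X_b^n$ and $\ell<n$, let $\hat p_\ell(a^\ell|u^n)=\frac{1}{n-\ell}\,|\{i:\ell+1\le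 i\le n,\ (u_{i-\ell},\dots,u_{i-1})=a^\ell\}|$ be the $\ell$-th order empirical distribution of $u^n$. Let $r>1$, $\delta>0$, $c>0$, $b=b_n=\lfloor r\log\log n\rfloor$, $\lambda=\lambda_n=(\log n)^{2r}$, let $k=k_n\to\infty$ with $k_n=o(\log n/\log\log n)$, and let $m=m_n$ satisfy $$m_n\ge(1+\delta)\,\bar d_o(\mathbf X)\,n\quad\text{and}\quad m_n\ge c\,n$$ (the second condition follows from the first, for a suitable $c$, if $\bar d_o(\mathbf X)>0$). Let $Y^m=AX^n$, where $A=A_n\in\mathbb R^{m\times n}$ has i.i.d. $\mathcal N(0,1)$ entries and is independent of $X^n$. For every $n$ let $q_{k+1}$ be a probability distribution on $\mathcal X_b^{k+1}$ (it may be random, and may depend on $X^n$ and $A$), and let the weights be $$W_{a^{k+1}}=-\log q_{k+1}(a_{k+1}|a^k)\in[0,\infty],\qquad a^{k+1}\in\mathcal X_b^{k+1},\qquad -\log 0=\infty,$$ where $q_{k+1}(a_{k+1}|a^k)=q_{k+1}(a^{k+1})/q_{k+1}(a^k)$ and $q_{k+1}(a^k)$ is the marginal probability of $a^k$; when $q_{k+1}(a^k)=0$,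 $q_{k+1}(\cdot|a^k)$ is an arbitrary sub-probability on $\mathcal X_b$ (for instance a probability distribution, or identically $0$). Suppose that, for every $\epsilon>0$, $$P\Big(\tfrac1b D_{\rm KL}\big(\hat p_{k+1}(\cdot|[X^n]_b)\,\big\|\,q_{k+1}\big)>\epsilon\Big)\to 0\qquad(n\to\infty).$$ Let $\hat X^n$ be any minimizer over $u^n\in\mathcal X_b^n$ of $$\sum_{a^{k+1}\in\mathcal X_b^{k+1}}W_{a^{k+1}}\,\hat p_{k+1}(a^{k+1}|u^n)+\frac{\lambda}{n^2}\|Au^n-Y^m\|_2^2\qquad(\infty\cdot 0=0).$$ Then $\frac1{\sqrt n}\|X^n-\hat X^n\|_2\to 0$ in probability as $n\to\infty$. -/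

import Mathlib

open MeasureTheory ProbabilityTheory Filter Topology Asymptotics
open scoped ENNReal NNReal

namespace AMEP

noncomputable section

/-- The `b`-bit quantization `[x]_b = ⌊x⌋ + ∑_{i=1}^b 2^{-i} a_i`, where `0.a_1a_2…` is the binary
expansion of `x - ⌊x⌋`; that is, `x` rounded down to a multiple of `2^{-b}`. -/
def quantize (b : ℕ) (x : ℝ) : ℝ := (⌊(2 : ℝ) ^ b * x⌋ : ℝ) / 2 ^ b

/-- The quantized alphabet `𝒳_b = {[x]_b : x ∈ 𝒳}`. -/
def quantSet (b : ℕ) (S : Set ℝ) : Set ℝ := quantize b '' S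

section RandomSource

variable {Ω : Type*} [MeasurableSpace Ω]

/-- Conditional Shannon entropy `H(U | V)` in bits of discrete random variables,
`∑_{v,u} P(V=v, U=u) log₂ (P(V=v) / P(V=v, U=u))`. -/
def condEntropy {β γ : Type*} (μ : Measure Ω) (U : Ω → β) (V : Ω → γ) : ℝ≥0∞ :=
  ∑' v : γ, ∑' u : β, ENNReal.ofReal
    (μ.real {ω | V ω = v ∧ U ω = u} *
      Real.logb 2 (μ.real {ω | V ω = v} / μ.real {ω | V ω = v ∧ U ω = u}))

/-- The `k`-th order upper information dimension
`limsup_{b → ∞} H([X_{k+1}]_b | [X^k]_b) / b`. The process `X_1, X_2, …` is indexed from `0`, so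
that `X i` stands for `X_{i+1}`. -/
def upperInfoDimOrder (μ : Measure Ω) (X : ℕ → Ω → ℝ) (k : ℕ) : ℝ≥0∞ :=
  limsup (fun b : ℕ =>
    condEntropy μ (fun ω => quantize b (X k ω)) (fun ω (i : Fin k) => quantize b (X i ω)) / b)
    atTop

/-- `d` is the upper information dimension of `X`, the limit of its `k`-th order upper information
dimensions. -/
def IsUpperInfoDim (μ : Measure Ω) (X : ℕ → Ω → ℝ) (d : ℝ≥0) : Prop :=
  Tendsto (upperInfoDimOrder μ X) atTop (𝓝 (d : ℝ≥0∞))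

/-- (Strict) stationarity: all time shifts have the same law on path space. -/
def IsStationary (μ : Measure Ω) (X : ℕ → Ω → ℝ) : Prop :=
  ∀ t : ℕ, IdentDistrib (fun ω (i : ℕ) => X (i + t) ω) (fun ω (i : ℕ) => X i ω) μ μ

/-- The `σ`-field generated by the `X i` with `i ≤ j`. -/
@[reducible] def pastField (X : ℕ → Ω → ℝ) (j : ℕ) : MeasurableSpace Ω :=
  ⨆ i : ℕ, ⨆ _ : i ≤ j, MeasurableSpace.comap (X i) inferInstance

/-- The `σ`-field generated by the `X i` with `j ≤ i`. -/
@[reducible] def futureField (X : ℕ → Ω → ℝ) (j : ℕ) : MeasurableSpace Ω :=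
  ⨆ i : ℕ, ⨆ _ : j ≤ i, MeasurableSpace.comap (X i) inferInstance

/-- The mixing coefficient `ψ*(g) = sup P(A ∩ B) / (P(A) P(B))`, over all `j`, all events `A` of the
past up to `j` and all events `B` of the future from `j + g` with `P(A) P(B) > 0`. -/
def psiStar (μ : Measure Ω) (X : ℕ → Ω → ℝ) (g : ℕ) : ℝ≥0∞ :=
  ⨆ (j : ℕ) (A : Set Ω) (B : Set Ω) (_ : MeasurableSet[pastField X j] A)
    (_ : MeasurableSet[futureField X (j + g)] B) (_ : 0 < μ A * μ B), μ (A ∩ B) / (μ A * μ B)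

/-- `Ψ*`-mixing: `ψ*(g) → 1` as `g → ∞`. -/
def IsPsiStarMixing (μ : Measure Ω) (X : ℕ → Ω → ℝ) : Prop :=
  Tendsto (psiStar μ X) atTop (𝓝 1)

end RandomSource

section Empirical

variable {α : Type*}

/-- The block of length `k` of `u` that starts at position `j`. -/
def window {n : ℕ} (k : ℕ) (u : Fin n → α) (j : Fin (n - k)) : Fin k → α :=
  fun l => u ⟨j + l, by omega⟩

open Classical in
/-- The `k`-th order empirical distribution
`p̂_k(a | u^n) = |{i : u_{i-k}^{i-1} = a, k+1 ≤ i ≤ n}| / (n - k)`. -/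
def empDist {n : ℕ} (k : ℕ) (u : Fin n → α) (a : Fin k → α) : ℝ≥0∞ :=
  ((Finset.univ.filter fun j : Fin (n - k) => window k u j = a).card : ℝ≥0∞) / ((n - k : ℕ) : ℝ≥0∞)

/-- `p̂_k(· | u^n)` as a (discrete) measure. -/
def empMeasure [MeasurableSpace α] {n : ℕ} (k : ℕ) (u : Fin n → α) : Measure (Fin k → α) :=
  Measure.sum fun a : Fin k → α => empDist k u a • Measure.dirac a

/-- `D_KL(p̂_k(· | u^n) ‖ q)` in bits. -/
def klBits [MeasurableSpace α] {n k : ℕ} (u : Fin n → α) (q : PMF (Fin k → α)) : ℝ≥0∞ :=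
  InformationTheory.klDiv (empMeasure k u) q.toMeasure / ENNReal.ofReal (Real.log 2)

/-- The probability `q(a^k)` that `q = q_{k+1}` gives to the first `k` coordinates. -/
def marginal {k : ℕ} (q : PMF (Fin (k + 1) → α)) (v : Fin k → α) : ℝ≥0∞ :=
  ∑' x : α, q (Fin.snoc v x)

/-- `κ v x` is a conditional probability `q(x | v)` of the last coordinate given the first `k`.
It is `q(v, x) / q(v)` when `q(v) ≠ 0`. When `q(v) = 0` this quotient is undefined and `κ v` may be
any sub-probability, so both an arbitrary distribution and `κ v = 0` are allowed. -/
def IsCondProb {k : ℕ} (q : PMF (Fin (k + 1) → α)) (κ : (Fin k → α) → α → ℝ≥0∞) : Prop :=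
  (∀ v x, marginal q v ≠ 0 → κ v x = q (Fin.snoc v x) / marginal q v) ∧
    ∀ v, marginal q v = 0 → ∑' x, κ v x ≤ 1

/-- `-log₂ p` for a probability `p`, with `-log₂ 0 = ∞`. -/
def negLogTwo (p : ℝ≥0∞) : ℝ≥0∞ :=
  if p = 0 then ∞ else ENNReal.ofReal (-Real.logb 2 p.toReal)

/-- `c_w(u^n) = ∑_{a^{k+1}} w_{a^{k+1}} p̂_{k+1}(a^{k+1} | u^n)`, with `∞ * 0 = 0`. -/
def linCost {n k : ℕ} (w : (Fin (k + 1) → α) → ℝ≥0∞) (u : Fin n → α) : ℝ≥0∞ :=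
  ∑' a : Fin (k + 1) → α, w a * empDist (k + 1) u a

end Empirical

/-- The coordinatewise quantization `[x^n]_b` of a vector with entries in `S`. -/
def quantVec {n : ℕ} (b : ℕ) {S : Set ℝ} (x : Fin n → ℝ) (hx : ∀ i, x i ∈ S) :
    Fin n → quantSet b S :=
  fun i => ⟨quantize b (x i), Set.mem_image_of_mem _ (hx i)⟩

/-- The objective `c_w(u) + (lam / n²) ‖A u - y‖₂²`. -/
def objective {n m k : ℕ} {T : Set ℝ} (w : (Fin (k + 1) → T) → ℝ≥0∞) (lam : ℝ)
    (A : Matrix (Fin m) (Fin n) ℝ) (y : Fin m → ℝ) (u : Fin n → T) : ℝ≥0∞ :=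
  linCost w u + ENNReal.ofReal
    (lam / (n : ℝ) ^ 2 * ‖WithLp.toLp 2 (A.mulVec (fun i => (u i : ℝ)) - y)‖ ^ 2)

/-- The number of quantization bits `b_n = ⌊r log₂ log₂ n⌋`. -/
def bits (r : ℝ) (n : ℕ) : ℕ := ⌊r * Real.logb 2 (Real.logb 2 n)⌋₊

/-- The regularization parameter `λ_n = (log₂ n)^{2r}`. -/
def regParam (r : ℝ) (n : ℕ) : ℝ := (Real.logb 2 n) ^ (2 * r)

end

end AMEP

namespace AMEP

/-! ### Counting sequences with a short conditional code -/

section Counting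

variable {α : Type*}

/-! The linear part of the objective is a code length per symbol, so the minimizer is confined to a
set of cheap sequences, and a Gaussian matrix with enough rows separates all of them from the true
signal.

Upper bound on the optimum. The competitor is the quantized source. By Gibbs' inequality its cost is
at most the divergence to `q` plus its cost under any other kernel (`linCost_le_klBits_add`). The
comparison kernel is a smoothed conditional law of a fixed order `k₀` whose information dimension is
close to `d`; its expected code length is within one bit of the conditional entropy, and a weak law
for `Ψ*`-mixing block sums carries this over to the sample path
(`tendsto_measure_linCost_quantVec`). The cost is thus at most `b d'` with high probability, for any
`d' > d`. The misfit of the competitor is only quantization noise, controlled by Markov's inequality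
(`measure_quantization_error_ge_le`).

Size of the cheap set. For one kernel, Kraft's inequality bounds the number of sequences of cost at
most `L` by `2 ^ (n L)` up to a small factor. The weights may depend on the signal and on the
matrix, so all kernels are allowed at once: the cost depends on a sequence only through its
empirical counts, and there are few tables of counts (`ncard_cheapSet_le`). The cheap set is then
deterministic and a union bound over it is legitimate.

Separation. For fixed `v`, a Chernoff bound gives `‖A v‖² ≤ σ² m ‖v‖²` with probability at most
`(e^{1/2} σ)^m`. With `σ = 2 ^ (-b (1 - γ/2))` this beats the count `2 ^ (b m (1 - 3γ/4))` once `b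
γ` is large. Outside the exceptional events, the small misfit of the minimizer forces a mean squared
error of at most `b 2 ^ (-γ b)`, which tends to `0`. -/

theorem snoc_apply_of_lt {n : ℕ} (u : Fin n → α) (x : α) {i : ℕ} (hi : i < n) (h' : i < n + 1) :
    (Fin.snoc u x : Fin (n + 1) → α) ⟨i, h'⟩ = u ⟨i, hi⟩ := by
  simp [Fin.snoc, hi]

theorem sum_pi_snoc [Fintype α] {n : ℕ} {R : Type*} [AddCommMonoid R]
    (f : (Fin (n + 1) → α) → R) :
    ∑ u, f u = ∑ v : Fin n → α, ∑ x : α, f (Fin.snoc v x) := by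
  rw [← (Fin.snocEquiv fun _ : Fin (n + 1) => α).sum_comp, Fintype.sum_prod_type_right]
  rfl

/-- A product of sub-probability transition kernels has total mass at most that of the
free coordinates. -/
theorem sum_prod_kernel_le [Fintype α] {k : ℕ} (κ : (Fin k → α) → α → ℝ≥0∞)
    (hκ : ∀ v, ∑ x, κ v x ≤ 1) (n : ℕ) : ∀ (M : ℕ) (h : M + k ≤ n),
    ∑ u : Fin n → α, ∏ j : Fin M, κ (fun l => u ⟨j + l, by omega⟩) (u ⟨j + k, by omega⟩)
      ≤ (Fintype.card α : ℝ≥0∞) ^ (n - M) := by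
  induction n with
  | zero =>
    intro M h
    obtain rfl : M = 0 := by omega
    simp
  | succ n ih =>
    intro M h
    rw [sum_pi_snoc]
    by_cases hM : M + k ≤ n
    · calc _ = ∑ v : Fin n → α, ∑ x : α, ∏ j : Fin M,
            κ (fun l => v ⟨j + l, by omega⟩) (v ⟨j + k, by omega⟩) := by
            refine Finset.sum_congr rfl fun v _ => Finset.sum_congr rfl fun x _ =>
              Finset.prod_congr rfl fun j _ => ?_
            rw [snoc_apply_of_lt v x (by omega)]
            congr 1
            ext l
            rw [snoc_apply_of_lt v x (by omega)]
        _ = (Fintype.card α : ℝ≥0∞) * ∑ v : Fin n → α, ∏ j : Fin M,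
            κ (fun l => v ⟨j + l, by omega⟩) (v ⟨j + k, by omega⟩) := by
            simp [Finset.mul_sum]
        _ ≤ (Fintype.card α : ℝ≥0∞) * (Fintype.card α : ℝ≥0∞) ^ (n - M) := by
            gcongr
            exact ih M hM
        _ = _ := by
            rw [← pow_succ']
            congr 1
            omega
    -- Here the last factor ends exactly at the last coordinate, so summing that coordinate out uses
    -- the sub-probability bound.
    · rcases M with _ | M
      · simp [pow_succ]
      · obtain rfl : n = M + k := by omega
        calc _ = ∑ v : Fin (M + k) → α, ∑ x : α, (∏ j : Fin M,
              κ (fun l => v ⟨j + l, by omega⟩) (v ⟨j + k, by omega⟩)) *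
              κ (fun l => v ⟨M + l, by omega⟩) x := by
              refine Finset.sum_congr rfl fun v _ => Finset.sum_congr rfl fun x _ => ?_
              rw [Fin.prod_univ_castSucc]
              congr 1
              · refine Finset.prod_congr rfl fun j _ => ?_
                simp only [Fin.val_castSucc]
                rw [snoc_apply_of_lt v x (by omega)]
                congr 1
                ext l
                rw [snoc_apply_of_lt v x (by omega)]
              · simp only [Fin.val_last]
                congr 1
                · ext l
                  rw [snoc_apply_of_lt v x (by omega)]
                · simp [Fin.snoc]
          _ ≤ ∑ v : Fin (M + k) → α, ∏ j : Fin M,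
              κ (fun l => v ⟨j + l, by omega⟩) (v ⟨j + k, by omega⟩) := by
              refine Finset.sum_le_sum fun v _ => ?_
              rw [← Finset.mul_sum]
              exact mul_le_of_le_one_right' (hκ _)
          _ ≤ _ := by
              refine (ih M le_rfl).trans_eq ?_
              congr 1
              omega

theorem linCost_eq_sum_window [Finite α] {n k : ℕ} (w : (Fin (k + 1) → α) → ℝ≥0∞)
    (u : Fin n → α) :
    linCost w u = (∑ j, w (window (k + 1) u j)) / ((n - (k + 1) : ℕ) : ℝ≥0∞) := by
  classical
  have := Fintype.ofFinite α
  simp only [linCost, tsum_fintype, empDist, div_eq_mul_inv, ← mul_assoc]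
  rw [← Finset.sum_mul]
  congr 1
  simp_rw [Finset.card_eq_sum_ones, Nat.cast_sum, Finset.sum_filter, Finset.mul_sum]
  rw [Finset.sum_comm]
  refine Finset.sum_congr rfl fun j _ => ?_
  simp

theorem ofReal_rpow_le_prod_of_sum_negLogTwo_le {ι : Type*} (s : Finset ι) (p : ι → ℝ≥0∞)
    (hp : ∀ i ∈ s, p i ≤ 1) {t : ℝ} (h : ∑ i ∈ s, negLogTwo (p i) ≤ ENNReal.ofReal t)
    (ht : 0 ≤ t) : ENNReal.ofReal (2 ^ (-t)) ≤ ∏ i ∈ s, p i := by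
  have hp0 : ∀ i ∈ s, p i ≠ 0 := by
    intro i hi h0
    have h1 : negLogTwo (p i) ≤ ∑ i ∈ s, negLogTwo (p i) :=
      Finset.single_le_sum (f := fun i => negLogTwo (p i)) (fun _ _ => zero_le) hi
    rw [h0, negLogTwo, if_pos rfl] at h1
    exact absurd (h1.trans h) (by simp)
  have hpt : ∀ i ∈ s, p i ≠ ∞ := fun i hi => ne_top_of_le_ne_top ENNReal.one_ne_top (hp i hi)
  have hpos : ∀ i ∈ s, 0 < (p i).toReal := fun i hi => ENNReal.toReal_pos (hp0 i hi) (hpt i hi)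
  have hle : ∀ i ∈ s, (p i).toReal ≤ 1 := fun i hi => by
    simpa using ENNReal.toReal_mono ENNReal.one_ne_top (hp i hi)
  have hnn : ∀ i ∈ s, 0 ≤ -Real.logb 2 (p i).toReal := fun i hi =>
    neg_nonneg.2 (Real.logb_nonpos one_lt_two (hpos i hi).le (hle i hi))
  have h2 : ∑ i ∈ s, -Real.logb 2 (p i).toReal ≤ t := by
    rw [← ENNReal.ofReal_le_ofReal_iff ht, ENNReal.ofReal_sum_of_nonneg hnn]
    refine le_trans (le_of_eq (Finset.sum_congr rfl fun i hi => ?_)) h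
    rw [negLogTwo, if_neg (hp0 i hi)]
  have h3 : ∏ i ∈ s, p i = ENNReal.ofReal (2 ^ (-∑ i ∈ s, -Real.logb 2 (p i).toReal)) := by
    rw [Finset.sum_neg_distrib, neg_neg, Real.rpow_sum_of_pos two_pos,
      ENNReal.ofReal_prod_of_nonneg fun i _ => by positivity]
    refine Finset.prod_congr rfl fun i hi => ?_
    rw [Real.rpow_logb two_pos (by norm_num) (hpos i hi), ENNReal.ofReal_toReal (hpt i hi)]
  rw [h3]
  exact ENNReal.ofReal_le_ofReal (Real.rpow_le_rpow_of_exponent_le one_le_two (by linarith))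

/-- The sequences whose cost is at most `L` for the weights of some sub-probability kernel. -/
def cheapSet (n k : ℕ) (α : Type*) (L : ℝ) : Set (Fin n → α) :=
  {u | ∃ κ : (Fin k → α) → α → ℝ≥0∞, (∀ v, ∑' x, κ v x ≤ 1) ∧
    linCost (fun a : Fin (k + 1) → α => negLogTwo (κ (Fin.init a) (a (Fin.last k)))) u
      ≤ ENNReal.ofReal L}

/-- Kraft's inequality: a cheap sequence has kernel product at least `2 ^ (-n L)`, while these
products sum to at most the number of choices of the free coordinates. There are `k + 1` of these
rather than `k`, because only `n - (k + 1)` windows are counted and the final symbol ends none of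
them. -/
theorem card_le_of_linCost_le [Fintype α] {n k : ℕ} (hn : k + 1 < n) {L : ℝ} (hL : 0 ≤ L)
    (κ : (Fin k → α) → α → ℝ≥0∞) (hκ : ∀ v, ∑' x, κ v x ≤ 1) (s : Finset (Fin n → α))
    (hs : ∀ u ∈ s,
      linCost (fun a : Fin (k + 1) → α => negLogTwo (κ (Fin.init a) (a (Fin.last k)))) u
        ≤ ENNReal.ofReal L) :
    (s.card : ℝ) ≤ (Fintype.card α : ℝ) ^ (k + 1) * 2 ^ ((n : ℝ) * L) := by
  have hκ' : ∀ v, ∑ x, κ v x ≤ 1 := fun v => by simpa using hκ v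
  have hκ1 : ∀ v x, κ v x ≤ 1 := fun v x =>
    (Finset.single_le_sum (f := κ v) (fun _ _ => zero_le) (Finset.mem_univ x)).trans (hκ' v)
  have hN : ((n - (k + 1) : ℕ) : ℝ) ≤ n := by exact_mod_cast Nat.sub_le _ _
  have key : ∀ u ∈ s, ENNReal.ofReal (2 ^ (-((n : ℝ) * L))) ≤
      ∏ j : Fin (n - (k + 1)), κ (fun l => u ⟨j + l, by omega⟩) (u ⟨j + k, by omega⟩) := by
    intro u hu
    have h1 := hs u hu
    rw [linCost_eq_sum_window, ENNReal.div_le_iff (Nat.cast_ne_zero.2 (by omega)) (by simp)] at h1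
    have h2 := ofReal_rpow_le_prod_of_sum_negLogTwo_le Finset.univ
      (fun j : Fin (n - (k + 1)) => κ (Fin.init (window (k + 1) u j))
        (window (k + 1) u j (Fin.last k))) (fun _ _ => hκ1 _ _) (t := n * L)
      (h1.trans (by
        rw [mul_comm (n : ℝ), ENNReal.ofReal_mul hL, ENNReal.ofReal_natCast]
        gcongr
        omega)) (by positivity)
    exact h2
  have h3 : (s.card : ℝ≥0∞) * ENNReal.ofReal (2 ^ (-((n : ℝ) * L))) ≤
      (Fintype.card α : ℝ≥0∞) ^ (k + 1) := by
    calc _ = ∑ u ∈ s, ENNReal.ofReal (2 ^ (-((n : ℝ) * L))) := by simp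
      _ ≤ ∑ u ∈ s, ∏ j : Fin (n - (k + 1)),
          κ (fun l => u ⟨j + l, by omega⟩) (u ⟨j + k, by omega⟩) := Finset.sum_le_sum key
      _ ≤ ∑ u : Fin n → α, ∏ j : Fin (n - (k + 1)),
          κ (fun l => u ⟨j + l, by omega⟩) (u ⟨j + k, by omega⟩) :=
          Finset.sum_le_sum_of_subset (Finset.subset_univ s)
      _ ≤ _ := by
          refine (sum_prod_kernel_le κ hκ' n (n - (k + 1)) (by omega)).trans_eq ?_
          congr 1
          omega
  have h4 := ENNReal.toReal_mono (by simp) h3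
  rw [ENNReal.toReal_mul, ENNReal.toReal_ofReal (by positivity), ENNReal.toReal_pow,
    ENNReal.toReal_natCast, ENNReal.toReal_natCast, Real.rpow_neg two_pos.le] at h4
  rwa [← div_eq_mul_inv, div_le_iff₀ (by positivity)] at h4

/-- Two sequences with the same counts have the same cost under every kernel. Hence within one class
of counts a single witness kernel serves all members, and the fixed-kernel bound applies; the first
factor bounds the number of classes. -/
theorem ncard_cheapSet_le [Fintype α] {n k : ℕ} (hn : k + 1 < n) {L : ℝ} (hL : 0 ≤ L) :
    ((cheapSet n k α L).ncard : ℝ) ≤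
      ((n : ℝ) + 1) ^ (Fintype.card α ^ (k + 1)) *
        ((Fintype.card α : ℝ) ^ (k + 1) * 2 ^ ((n : ℝ) * L)) := by
  classical
  let table : (Fin n → α) → (Fin (k + 1) → α) → Fin (n + 1) := fun u a =>
    ⟨(Finset.univ.filter fun j : Fin (n - (k + 1)) => window (k + 1) u j = a).card, by
      have := Finset.card_le_univ
        (Finset.univ.filter fun j : Fin (n - (k + 1)) => window (k + 1) u j = a)
      simp only [Fintype.card_fin] at this
      omega⟩
  have htable : ∀ u u', table u = table u' → empDist (k + 1) u = empDist (k + 1) u' := by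
    intro u u' h
    ext a
    have := congrArg Fin.val (congrFun h a)
    simp only [table] at this
    simp only [empDist]
    congr 2
  have hcost : ∀ (u u' : Fin n → α) (w : (Fin (k + 1) → α) → ℝ≥0∞),
      table u = table u' → linCost w u = linCost w u' := by
    intro u u' w h
    simp only [linCost, htable u u' h]
  set s := (cheapSet n k α L).toFinite.toFinset with hs
  have hfib : ∀ t : (Fin (k + 1) → α) → Fin (n + 1),
      ((s.filter fun u => table u = t).card : ℝ) ≤
        (Fintype.card α : ℝ) ^ (k + 1) * 2 ^ ((n : ℝ) * L) := by
    intro t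
    rcases (s.filter fun u => table u = t).eq_empty_or_nonempty with h0 | ⟨u0, hu0⟩
    · rw [h0, Finset.card_empty, Nat.cast_zero]
      positivity
    · rw [Finset.mem_filter, hs, Set.Finite.mem_toFinset] at hu0
      obtain ⟨⟨κ, hκ, hc⟩, ht⟩ := hu0
      refine card_le_of_linCost_le hn hL κ hκ _ fun u hu => ?_
      rw [Finset.mem_filter] at hu
      rw [hcost u u0 _ (hu.2.trans ht.symm)]
      exact hc
  rw [Set.ncard_eq_toFinset_card _ (cheapSet n k α L).toFinite, ← hs,
    Finset.card_eq_sum_card_fiberwise (f := table) (t := Finset.univ) (fun _ _ => by simp)]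
  push_cast
  refine (Finset.sum_le_sum fun t _ => hfib t).trans_eq ?_
  rw [Finset.sum_const, nsmul_eq_mul]
  simp

end Counting

/-! ### Gibbs' inequality for conditional code lengths -/

section Divergence

variable {α : Type*}

theorem sum_empDist [Fintype α] {n k : ℕ} (hn : k + 1 < n) (u : Fin n → α) :
    ∑ a, empDist (k + 1) u a = 1 := by
  have h := linCost_eq_sum_window (fun _ : Fin (k + 1) → α => (1 : ℝ≥0∞)) u
  simp only [linCost, one_mul, tsum_fintype, Finset.sum_const, Finset.card_univ,
    Fintype.card_fin, nsmul_eq_mul, mul_one] at h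
  rw [h, ENNReal.div_self (Nat.cast_ne_zero.2 (by omega)) (by simp)]

theorem empMeasure_singleton [Fintype α] [MeasurableSpace α] [MeasurableSingletonClass α]
    {n k : ℕ} (u : Fin n → α) (a : Fin k → α) : empMeasure k u {a} = empDist k u a := by
  classical
  rw [empMeasure, Measure.sum_apply _ (measurableSet_singleton a), tsum_fintype]
  simp [Measure.dirac_apply' _ (measurableSet_singleton a), Set.indicator_apply]

theorem isProbabilityMeasure_empMeasure [Fintype α] [MeasurableSpace α]
    [MeasurableSingletonClass α] {n k : ℕ} (hn : k + 1 < n) (u : Fin n → α) :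
    IsProbabilityMeasure (empMeasure (k + 1) u) := by
  classical
  constructor
  rw [empMeasure, Measure.sum_apply _ MeasurableSet.univ, tsum_fintype]
  simpa using sum_empDist hn u

/-- The divergence between two distributions on a finite type, in real terms. -/
theorem toReal_klDiv_fintype {β : Type*} [Fintype β] [MeasurableSpace β]
    [MeasurableSingletonClass β] (P R : Measure β) [IsProbabilityMeasure P]
    [IsProbabilityMeasure R] (h : InformationTheory.klDiv P R ≠ ∞) :
    (InformationTheory.klDiv P R).toReal =
      ∑ a, P.real {a} * Real.log (P.real {a} / R.real {a}) := by
  obtain ⟨hac, hint⟩ := InformationTheory.klDiv_ne_top_iff.1 h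
  rw [InformationTheory.toReal_klDiv_of_measure_eq hac (by simp), integral_fintype hint]
  refine Finset.sum_congr rfl fun a _ => ?_
  rw [smul_eq_mul, llr]
  by_cases hR : R {a} = 0
  · simp [measureReal_def, hac hR]
  congr 2
  have h1 : (R.withDensity (P.rnDeriv R)) {a} = P {a} := by
    rw [Measure.withDensity_rnDeriv_eq _ _ hac]
  rw [withDensity_apply _ (measurableSet_singleton a), lintegral_singleton] at h1
  rw [measureReal_def, measureReal_def, ← h1, ENNReal.toReal_mul,
    mul_div_cancel_right₀ _ (ENNReal.toReal_ne_zero.2 ⟨hR, by simp⟩)]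

theorem sum_pi_fin_succ [Fintype α] {k : ℕ} {R : Type*} [AddCommMonoid R]
    (f : (Fin k → α) → α → R) :
    ∑ a : Fin (k + 1) → α, f (Fin.init a) (a (Fin.last k)) = ∑ v, ∑ x, f v x := by
  rw [sum_pi_snoc]
  simp

/-- The cost with weights `-log₂ κ`, `κ` the conditional law of `q`, exceeds the cost with weights
`-log₂ Q` for any other kernel `Q` by at most the divergence from `q`. -/
theorem linCost_le_klBits_add [Fintype α] [MeasurableSpace α] [MeasurableSingletonClass α]
    {n k : ℕ} (hn : k + 1 < n) (u : Fin n → α) (q : PMF (Fin (k + 1) → α))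
    (κ : (Fin k → α) → α → ℝ≥0∞) (hκ : IsCondProb q κ) (Q : (Fin k → α) → α → ℝ)
    (hQ0 : ∀ v x, 0 < Q v x) (hQ1 : ∀ v, ∑ x, Q v x ≤ 1) :
    linCost (fun a : Fin (k + 1) → α => negLogTwo (κ (Fin.init a) (a (Fin.last k)))) u ≤
      klBits u q + linCost (fun a : Fin (k + 1) → α =>
        ENNReal.ofReal (-Real.logb 2 (Q (Fin.init a) (a (Fin.last k))))) u := by
  have hl2 : 0 < Real.log 2 := Real.log_pos one_lt_two
  have hprob := isProbabilityMeasure_empMeasure hn u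
  by_cases htop : InformationTheory.klDiv (empMeasure (k + 1) u) q.toMeasure = ∞
  · simp [klBits, htop, ENNReal.top_div]
  have hac := (InformationTheory.klDiv_ne_top_iff.1 htop).1
  have hkl := toReal_klDiv_fintype _ _ htop
  set p : (Fin (k + 1) → α) → ℝ := fun a => (empDist (k + 1) u a).toReal with hp
  set qr : (Fin (k + 1) → α) → ℝ := fun a => (q a).toReal with hqr
  set mr : (Fin k → α) → ℝ := fun v => (marginal q v).toReal with hmr
  have hPa : ∀ a, (empMeasure (k + 1) u).real {a} = p a := fun a => by
    rw [measureReal_def, empMeasure_singleton]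
  have hRa : ∀ a, q.toMeasure.real {a} = qr a := fun a => by
    rw [measureReal_def, PMF.toMeasure_apply_singleton _ _ (measurableSet_singleton a)]
  simp only [hPa, hRa] at hkl
  have hsum := sum_empDist hn u
  have hemptop : ∀ a, empDist (k + 1) u a ≠ ∞ := fun a =>
    ne_top_of_le_ne_top ENNReal.one_ne_top
      (hsum ▸ Finset.single_le_sum (fun _ _ => zero_le) (Finset.mem_univ a))
  have hpsum : ∑ a, p a = 1 := by
    rw [hp, ← ENNReal.toReal_sum fun a _ => hemptop a, hsum, ENNReal.toReal_one]
  have hmarg : ∀ v, marginal q v = ∑ x, q (Fin.snoc v x) := fun v => tsum_fintype _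
  have hmsum : ∑ v, mr v = 1 := by
    have h1 : ∑ v, marginal q v = 1 := by
      simp_rw [hmarg]
      rw [← sum_pi_snoc (fun a => q a), ← tsum_fintype (L := .unconditional _), q.tsum_coe]
    have h2 : ∀ v, marginal q v ≠ ∞ := fun v =>
      ne_top_of_le_ne_top ENNReal.one_ne_top
        (h1 ▸ Finset.single_le_sum (fun _ _ => zero_le) (Finset.mem_univ v))
    rw [hmr, ← ENNReal.toReal_sum fun v _ => h2 v, h1, ENNReal.toReal_one]
  have hmtop : ∀ v, marginal q v ≠ ∞ := by
    intro v
    rw [hmarg]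
    exact ENNReal.sum_ne_top.2 fun x _ => q.apply_ne_top _
  have hqm : ∀ a, q a ≤ marginal q (Fin.init a) := by
    intro a
    rw [hmarg]
    refine le_trans (le_of_eq ?_) (Finset.single_le_sum
      (f := fun x => q (Fin.snoc (Fin.init a) x)) (fun _ _ => zero_le)
      (Finset.mem_univ (a (Fin.last k))))
    simp
  -- Finite divergence gives absolute continuity, so every observed window has positive `q`-mass and
  -- the arbitrary values of `κ` on null contexts never enter the cost.
  have hq0 : ∀ a, empDist (k + 1) u a ≠ 0 → q a ≠ 0 := by
    intro a ha h0
    refine ha ?_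
    rw [← empMeasure_singleton]
    refine hac ?_
    rw [PMF.toMeasure_apply_singleton _ _ (measurableSet_singleton a), h0]
  have hQle : ∀ v x, Q v x ≤ 1 := fun v x =>
    (Finset.single_le_sum (f := Q v) (fun x _ => (hQ0 v x).le) (Finset.mem_univ x)).trans (hQ1 v)
  have hp0 : ∀ a, 0 ≤ p a := fun a => ENNReal.toReal_nonneg
  have hqrpos : ∀ a, 0 < p a → 0 < qr a ∧ 0 < mr (Fin.init a) ∧ qr a ≤ mr (Fin.init a) := by
    intro a ha
    have h1 := hq0 a (fun h => by simp [hp, h] at ha)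
    have h2 : 0 < qr a := ENNReal.toReal_pos h1 (q.apply_ne_top a)
    have h3 : qr a ≤ mr (Fin.init a) := ENNReal.toReal_mono (hmtop _) (hqm a)
    exact ⟨h2, h2.trans_le h3, h3⟩
  have hnn1 : ∀ a, 0 ≤ p a * -Real.logb 2 (qr a / mr (Fin.init a)) := by
    intro a
    rcases (hp0 a).eq_or_lt with h | h
    · simp [← h]
    · obtain ⟨h1, h2, h3⟩ := hqrpos a h
      exact mul_nonneg h.le (neg_nonneg.2 (Real.logb_nonpos one_lt_two (div_nonneg h1.le h2.le)
        ((div_le_one h2).2 h3)))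
  have hnn2 : ∀ a : Fin (k + 1) → α,
      0 ≤ p a * -Real.logb 2 (Q (Fin.init a) (a (Fin.last k))) := fun a =>
    mul_nonneg (hp0 a) (neg_nonneg.2 (Real.logb_nonpos one_lt_two (hQ0 _ _).le (hQle _ _)))
  have hL : linCost (fun a : Fin (k + 1) → α => negLogTwo (κ (Fin.init a) (a (Fin.last k)))) u =
      ENNReal.ofReal (∑ a, p a * -Real.logb 2 (qr a / mr (Fin.init a))) := by
    rw [linCost, tsum_fintype, ENNReal.ofReal_sum_of_nonneg fun a _ => hnn1 a]
    refine Finset.sum_congr rfl fun a _ => ?_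
    by_cases ha : empDist (k + 1) u a = 0
    · simp [hp, ha]
    · have hqa := hq0 a ha
      have hma : marginal q (Fin.init a) ≠ 0 := fun h => hqa (by simpa [h] using hqm a)
      have hka : κ (Fin.init a) (a (Fin.last k)) = q a / marginal q (Fin.init a) := by
        rw [hκ.1 _ _ hma, Fin.snoc_init_self]
      rw [hka, negLogTwo, if_neg (by simp [ENNReal.div_eq_zero_iff, hqa, hmtop]),
        ENNReal.ofReal_mul (hp0 a), mul_comm, ENNReal.toReal_div,
        hp, ENNReal.ofReal_toReal (hemptop a)]
  have hR : linCost (fun a : Fin (k + 1) → α =>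
        ENNReal.ofReal (-Real.logb 2 (Q (Fin.init a) (a (Fin.last k))))) u =
      ENNReal.ofReal (∑ a, p a * -Real.logb 2 (Q (Fin.init a) (a (Fin.last k)))) := by
    rw [linCost, tsum_fintype, ENNReal.ofReal_sum_of_nonneg fun a _ => hnn2 a]
    refine Finset.sum_congr rfl fun a _ => ?_
    rw [ENNReal.ofReal_mul (hp0 a), mul_comm, hp, ENNReal.ofReal_toReal (hemptop a)]
  have hK : klBits u q = ENNReal.ofReal ((∑ a, p a * Real.log (p a / qr a)) / Real.log 2) := by
    rw [klBits, ← hkl, ENNReal.ofReal_div_of_pos hl2, ENNReal.ofReal_toReal htop]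
  have hklnn : 0 ≤ ∑ a, p a * Real.log (p a / qr a) := hkl ▸ ENNReal.toReal_nonneg
  rw [hL, hR, hK, ← ENNReal.ofReal_add (div_nonneg hklnn hl2.le)
    (Finset.sum_nonneg fun a _ => hnn2 a)]
  refine ENNReal.ofReal_le_ofReal ?_
  -- Gibbs' inequality for `p` against the sub-distribution `mr * Q`, termwise from `log x ≤ x - 1`
  -- at `x = mr * Q / p`. After summation the left side is nonnegative.
  have hterm : ∀ a : Fin (k + 1) → α,
      p a - mr (Fin.init a) * Q (Fin.init a) (a (Fin.last k)) ≤
      p a * Real.log (p a / qr a) - p a * Real.log (Q (Fin.init a) (a (Fin.last k))) +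
        p a * Real.log (qr a / mr (Fin.init a)) := by
    intro a
    rcases (hp0 a).eq_or_lt with h | h
    · have : 0 ≤ mr (Fin.init a) * Q (Fin.init a) (a (Fin.last k)) :=
        mul_nonneg ENNReal.toReal_nonneg (hQ0 _ _).le
      simp [← h, this]
    · obtain ⟨h1, h2, h3⟩ := hqrpos a h
      have hQa := hQ0 (Fin.init a) (a (Fin.last k))
      set x := mr (Fin.init a) * Q (Fin.init a) (a (Fin.last k)) / p a with hx
      have hxpos : 0 < x := by positivity
      have hlog := Real.log_le_sub_one_of_pos hxpos
      have hxl : Real.log x = Real.log (mr (Fin.init a)) +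
          Real.log (Q (Fin.init a) (a (Fin.last k))) - Real.log (p a) := by
        rw [hx, Real.log_div (by positivity) h.ne', Real.log_mul h2.ne' hQa.ne']
      rw [Real.log_div h.ne' h1.ne', Real.log_div h1.ne' h2.ne']
      have hpx : p a * x = mr (Fin.init a) * Q (Fin.init a) (a (Fin.last k)) := by
        rw [hx]; field_simp
      nlinarith [mul_le_mul_of_nonneg_left hlog h.le]
  have htot := Finset.sum_le_sum fun a (_ : a ∈ Finset.univ) => hterm a
  have hmQ : ∑ a : Fin (k + 1) → α, mr (Fin.init a) * Q (Fin.init a) (a (Fin.last k)) ≤ 1 := by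
    rw [sum_pi_fin_succ fun v x => mr v * Q v x, ← hmsum]
    refine Finset.sum_le_sum fun v _ => ?_
    rw [← Finset.mul_sum]
    exact mul_le_of_le_one_right ENNReal.toReal_nonneg (hQ1 v)
  rw [Finset.sum_sub_distrib, hpsum, Finset.sum_add_distrib, Finset.sum_sub_distrib] at htot
  simp only [Real.logb, ← neg_div, ← mul_div_assoc, ← Finset.sum_div, mul_neg,
    Finset.sum_neg_distrib]
  rw [← add_div, div_le_div_iff_of_pos_right hl2]
  linarith

end Divergence

/-! ### Weak law for block sums of a `Ψ*`-mixing process -/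

section Mixing

theorem measurable_ofReal_block {Ω : Type*} (mΩ : MeasurableSpace Ω) {X : ℕ → Ω → ℝ} {K t : ℕ}
    (hX : ∀ l : Fin K, Measurable (X (t + l))) {f : (Fin K → ℝ) → ℝ} (hf : Measurable f) :
    Measurable fun ω => ENNReal.ofReal (f fun l => X (t + l) ω) :=
  ENNReal.measurable_ofReal.comp (hf.comp (measurable_pi_lambda _ hX))

theorem measurable_pastField {Ω : Type*} (X : ℕ → Ω → ℝ) {i j : ℕ} (h : i ≤ j) :
    Measurable[pastField X j] (X i) :=
  (comap_measurable (X i)).mono (le_iSup₂_of_le i h le_rfl) le_rfl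

theorem measurable_futureField {Ω : Type*} (X : ℕ → Ω → ℝ) {i j : ℕ} (h : j ≤ i) :
    Measurable[futureField X j] (X i) :=
  (comap_measurable (X i)).mono (le_iSup₂_of_le i h le_rfl) le_rfl

variable {Ω : Type*} [MeasurableSpace Ω]

theorem pastField_le {X : ℕ → Ω → ℝ} (hX : ∀ i, Measurable (X i)) (j : ℕ) :
    pastField X j ≤ ‹MeasurableSpace Ω› :=
  iSup₂_le fun i _ => (hX i).comap_le

theorem futureField_le {X : ℕ → Ω → ℝ} (hX : ∀ i, Measurable (X i)) (j : ℕ) :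
    futureField X j ≤ ‹MeasurableSpace Ω› :=
  iSup₂_le fun i _ => (hX i).comap_le

theorem IsStationary.identDistrib_block {μ : Measure Ω} {X : ℕ → Ω → ℝ}
    (hs : IsStationary μ X) (K t : ℕ) :
    IdentDistrib (fun ω (l : Fin K) => X (t + l) ω) (fun ω (l : Fin K) => X l ω) μ μ := by
  have h := (hs t).comp (u := fun (x : ℕ → ℝ) (l : Fin K) => x l) (by fun_prop)
  simpa only [Function.comp_def, add_comm] using h

variable (μ : Measure Ω) [IsProbabilityMeasure μ] {X : ℕ → Ω → ℝ}

theorem measure_inter_le_psiStar_mul {j g : ℕ} {A B : Set Ω}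
    (hA : MeasurableSet[pastField X j] A) (hB : MeasurableSet[futureField X (j + g)] B) :
    μ (A ∩ B) ≤ psiStar μ X g * (μ A * μ B) := by
  by_cases h0 : μ A * μ B = 0
  · have : μ (A ∩ B) = 0 := by
      rcases mul_eq_zero.1 h0 with h | h
      · exact measure_mono_null Set.inter_subset_left h
      · exact measure_mono_null Set.inter_subset_right h
    simp [this]
  · rw [← ENNReal.div_le_iff h0 (ENNReal.mul_ne_top (by simp) (by simp))]
    exact le_iSup_of_le j <| le_iSup_of_le A <| le_iSup_of_le B <| le_iSup_of_le hA <|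
      le_iSup_of_le hB <| le_iSup_of_le (pos_iff_ne_zero.2 h0) le_rfl

theorem one_le_psiStar (g : ℕ) : 1 ≤ psiStar μ X g := by
  simpa using measure_inter_le_psiStar_mul μ (X := X) (j := 0) (g := g)
    (A := Set.univ) (B := Set.univ) MeasurableSet.univ MeasurableSet.univ

/-- The inequality for events is a domination of measures. Fixing `B`, `μ` restricted to `B` is
dominated on the past field, which lets `F` replace an indicator; then `μ` with density `F` is
dominated on the future field, which does the same for `G`. -/
theorem lintegral_mul_le_psiStar_mul (hX : ∀ i, Measurable (X i)) {j g : ℕ} {F G : Ω → ℝ≥0∞}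
    (hF : Measurable[pastField X j] F) (hG : Measurable[futureField X (j + g)] G) :
    ∫⁻ ω, F ω * G ω ∂μ ≤ psiStar μ X g * ((∫⁻ ω, F ω ∂μ) * ∫⁻ ω, G ω ∂μ) := by
  have hp := pastField_le hX j
  have hf := futureField_le hX (j + g)
  have step1 : ∀ B, MeasurableSet[futureField X (j + g)] B →
      ∫⁻ ω in B, F ω ∂μ ≤ psiStar μ X g * ((∫⁻ ω, F ω ∂μ) * μ B) := by
    intro B hB
    have hle : (μ.restrict B).trim hp ≤ (psiStar μ X g * μ B) • μ.trim hp := by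
      refine Measure.le_iff.2 fun A hA => ?_
      rw [Measure.smul_apply, trim_measurableSet_eq hp hA, trim_measurableSet_eq hp hA,
        Measure.restrict_apply (hp A hA), smul_eq_mul, mul_assoc, mul_comm (μ B)]
      exact measure_inter_le_psiStar_mul μ hA hB
    calc ∫⁻ ω in B, F ω ∂μ = ∫⁻ ω, F ω ∂((μ.restrict B).trim hp) := (lintegral_trim hp hF).symm
      _ ≤ ∫⁻ ω, F ω ∂((psiStar μ X g * μ B) • μ.trim hp) := lintegral_mono' hle le_rfl
      _ = _ := by
        rw [lintegral_smul_measure, lintegral_trim hp hF, smul_eq_mul]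
        ring
  have hF' : Measurable F := hF.mono hp le_rfl
  have hG' : Measurable G := hG.mono hf le_rfl
  have hle : (μ.withDensity F).trim hf ≤ (psiStar μ X g * ∫⁻ ω, F ω ∂μ) • μ.trim hf := by
    refine Measure.le_iff.2 fun B hB => ?_
    rw [Measure.smul_apply, trim_measurableSet_eq hf hB, trim_measurableSet_eq hf hB,
      withDensity_apply _ (hf B hB), smul_eq_mul, mul_assoc]
    exact step1 B hB
  calc ∫⁻ ω, F ω * G ω ∂μ = ∫⁻ ω, G ω ∂(μ.withDensity F) :=
        (lintegral_withDensity_eq_lintegral_mul μ hF' hG').symm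
    _ = ∫⁻ ω, G ω ∂((μ.withDensity F).trim hf) := (lintegral_trim hf hG).symm
    _ ≤ ∫⁻ ω, G ω ∂((psiStar μ X g * ∫⁻ ω, F ω ∂μ) • μ.trim hf) := lintegral_mono' hle le_rfl
    _ = _ := by
      rw [lintegral_smul_measure, lintegral_trim hf hG, smul_eq_mul]
      ring

theorem integral_mul_block_le (hX : ∀ i, Measurable (X i)) (hs : IsStationary μ X) {K : ℕ}
    {f : (Fin K → ℝ) → ℝ} (hf : Measurable f) (hf0 : ∀ x, 0 ≤ f x)
    {C : ℝ} (hfC : ∀ x, f x ≤ C) {g i j : ℕ} (hij : i + K + g ≤ j) (hg : psiStar μ X g ≠ ∞) :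
    ∫ ω, f (fun l => X (i + l) ω) * f (fun l => X (j + l) ω) ∂μ ≤
      (psiStar μ X g).toReal * (∫ ω, f (fun l => X l ω) ∂μ) ^ 2 := by
  have hblock : ∀ t, Measurable fun ω => f (fun l => X (t + l) ω) := fun t =>
    hf.comp (measurable_pi_lambda _ fun l => hX _)
  -- The index `i + K` is one more than the block needs; it avoids a truncated subtraction when `K =
  -- 0`.
  have hF : Measurable[pastField X (i + K)]
      fun ω => ENNReal.ofReal (f (fun l => X (i + l) ω)) :=
    measurable_ofReal_block _ (fun l => measurable_pastField X (by omega)) hf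
  have hG : Measurable[futureField X (i + K + g)]
      fun ω => ENNReal.ofReal (f (fun l => X (j + l) ω)) :=
    measurable_ofReal_block _ (fun l => measurable_futureField X (by omega)) hf
  have hid : ∀ t, ∫⁻ ω, ENNReal.ofReal (f (fun l => X (t + l) ω)) ∂μ =
      ∫⁻ ω, ENNReal.ofReal (f (fun l => X l ω)) ∂μ := fun t =>
    ((hs.identDistrib_block K t).comp
      (ENNReal.measurable_ofReal.comp hf)).lintegral_eq
  have h := lintegral_mul_le_psiStar_mul μ hX hF hG
  rw [hid i, hid j] at h
  have hint0 : ∫ ω, f (fun l => X l ω) ∂μ =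
      (∫⁻ ω, ENNReal.ofReal (f (fun l => X l ω)) ∂μ).toReal :=
    integral_eq_lintegral_of_nonneg_ae (Eventually.of_forall fun _ => hf0 _)
      (by simpa using (hblock 0).aestronglyMeasurable)
  rw [integral_eq_lintegral_of_nonneg_ae
    (Eventually.of_forall fun _ => mul_nonneg (hf0 _) (hf0 _))
    ((hblock i).mul (hblock j)).aestronglyMeasurable, hint0, sq, ← ENNReal.toReal_mul,
    ← ENNReal.toReal_mul]
  simp_rw [ENNReal.ofReal_mul (hf0 _)]
  have htop : ∫⁻ ω, ENNReal.ofReal (f (fun l => X l ω)) ∂μ ≠ ∞ :=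
    ne_top_of_le_ne_top (by simp : ENNReal.ofReal C * μ Set.univ ≠ ∞)
      ((lintegral_mono fun _ => ENNReal.ofReal_le_ofReal (hfC _)).trans_eq (lintegral_const _))
  exact ENNReal.toReal_mono (by finiteness) h

/-- Expanding the square, each block has at most `2 (K + g)` partners that are too close for mixing;
those products are bounded by `C ^ 2`, and all others by the `ψ*` estimate. -/
theorem integral_sq_sum_block_le (hX : ∀ i, Measurable (X i)) (hs : IsStationary μ X) {K : ℕ}
    {f : (Fin K → ℝ) → ℝ} (hf : Measurable f) (hf0 : ∀ x, 0 ≤ f x)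
    {C : ℝ} (hfC : ∀ x, f x ≤ C) {g : ℕ} (hg : psiStar μ X g ≠ ∞) (N s : ℕ) :
    ∫ ω, (∑ j ∈ Finset.range N, f (fun l => X (s + j + l) ω)) ^ 2 ∂μ ≤
      N * (2 * (K + g) * C ^ 2) +
        N ^ 2 * ((psiStar μ X g).toReal * (∫ ω, f (fun l => X l ω) ∂μ) ^ 2) := by
  have hblock : ∀ t, Measurable fun ω => f (fun l => X (t + l) ω) := fun t =>
    hf.comp (measurable_pi_lambda _ fun l => hX _)
  have hC : ∀ x y, f x * f y ≤ C ^ 2 := fun x y => by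
    rw [sq]
    exact mul_le_mul (hfC x) (hfC y) (hf0 y) ((hf0 x).trans (hfC x))
  have hint : ∀ i j, Integrable (fun ω => f (fun l => X (i + l) ω) * f (fun l => X (j + l) ω)) μ :=
    fun i j => Integrable.of_bound ((hblock i).mul (hblock j)).aestronglyMeasurable (C ^ 2)
      (Eventually.of_forall fun ω => by
        rw [Real.norm_of_nonneg (mul_nonneg (hf0 _) (hf0 _))]
        exact hC _ _)
  set e := (psiStar μ X g).toReal * (∫ ω, f (fun l => X l ω) ∂μ) ^ 2 with he
  have he0 : 0 ≤ e := by positivity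
  have hpair : ∀ i j, ∫ ω, f (fun l => X (s + i + l) ω) * f (fun l => X (s + j + l) ω) ∂μ ≤
      (if j ∈ Finset.Ico (i - (K + g)) (i + (K + g)) then C ^ 2 else 0) + e := by
    intro i j
    split_ifs with hj
    · calc _ ≤ ∫ _ω, C ^ 2 ∂μ := integral_mono (hint _ _) (integrable_const _) fun ω => hC _ _
        _ ≤ _ := by simpa using he0
    · rw [Finset.mem_Ico, not_and_or, not_le, not_lt] at hj
      rw [zero_add]
      rcases hj with hj | hj
      · simp_rw [mul_comm (f fun l => X (s + i + l) _)]
        exact integral_mul_block_le μ hX hs hf hf0 hfC (by omega) hg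
      · exact integral_mul_block_le μ hX hs hf hf0 hfC (by omega) hg
  have hcount : ∀ i, ∑ j ∈ Finset.range N,
      (if j ∈ Finset.Ico (i - (K + g)) (i + (K + g)) then C ^ 2 else 0) ≤ 2 * (K + g) * C ^ 2 := by
    intro i
    rw [← Finset.sum_filter, Finset.sum_const, nsmul_eq_mul]
    gcongr
    have : (Finset.filter (· ∈ Finset.Ico (i - (K + g)) (i + (K + g))) (Finset.range N)).card ≤
        2 * (K + g) := by
      refine (Finset.card_le_card (t := Finset.Ico (i - (K + g)) (i + (K + g))) fun j hj =>
        (Finset.mem_filter.1 hj).2).trans ?_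
      rw [Nat.card_Ico]
      omega
    exact_mod_cast this
  simp_rw [sq (∑ j ∈ Finset.range N, _), Finset.sum_mul_sum]
  rw [integral_finsetSum _ fun i _ => integrable_finsetSum _ fun j _ => hint _ _]
  simp_rw [integral_finsetSum _ fun j _ => hint _ _]
  calc _ ≤ ∑ i ∈ Finset.range N, (2 * (K + g) * C ^ 2 + N * e) := by
        refine Finset.sum_le_sum fun i _ => ?_
        refine (Finset.sum_le_sum fun j _ => hpair i j).trans ?_
        rw [Finset.sum_add_distrib, Finset.sum_const, Finset.card_range, nsmul_eq_mul]
        linarith [hcount i]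
    _ = _ := by
        rw [Finset.sum_const, Finset.card_range, nsmul_eq_mul]
        ring

/-- Chebyshev's inequality for block sums of a `Ψ*`-mixing process. -/
theorem measureReal_sum_block_ge_le (hX : ∀ i, Measurable (X i)) (hs : IsStationary μ X) {K : ℕ}
    {f : (Fin K → ℝ) → ℝ} (hf : Measurable f) (hf0 : ∀ x, 0 ≤ f x)
    {C : ℝ} (hfC : ∀ x, f x ≤ C) {g : ℕ} (hg : psiStar μ X g ≠ ∞) {N : ℕ} (hN : 0 < N) (s : ℕ)
    {ε : ℝ} (hε : 0 < ε) :
    μ.real {ω | N * (∫ ω, f (fun l => X l ω) ∂μ + ε) ≤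
        ∑ j ∈ Finset.range N, f (fun l => X (s + j + l) ω)} ≤
      2 * (K + g) * C ^ 2 / ε ^ 2 / N + ((psiStar μ X g).toReal - 1) * C ^ 2 / ε ^ 2 := by
  have hblock : ∀ t, Measurable fun ω => f (fun l => X (t + l) ω) := fun t =>
    hf.comp (measurable_pi_lambda _ fun l => hX _)
  have hN' : (0 : ℝ) < N := by exact_mod_cast hN
  set e := ∫ ω, f (fun l => X l ω) ∂μ with he
  set Z : Ω → ℝ := fun ω => ∑ j ∈ Finset.range N, f (fun l => X (s + j + l) ω) with hZ
  have hbdd : ∀ t, Integrable (fun ω => f (fun l => X (t + l) ω)) μ := fun t =>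
    Integrable.of_bound (hblock t).aestronglyMeasurable C (Eventually.of_forall fun ω => by
      rw [Real.norm_of_nonneg (hf0 _)]; exact hfC _)
  have hZm : Measurable Z := Finset.measurable_sum _ fun j _ => hblock _
  have hZL : MemLp Z 2 μ := MemLp.of_bound hZm.aestronglyMeasurable (N * C)
    (Eventually.of_forall fun ω => by
      rw [Real.norm_of_nonneg (Finset.sum_nonneg fun j _ => hf0 _)]
      refine (Finset.sum_le_sum fun j _ => hfC _).trans ?_
      simp)
  have hEZ : μ[Z] = N * e := by
    rw [hZ, integral_finsetSum _ fun j _ => hbdd _]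
    have : ∀ j, ∫ ω, f (fun l => X (s + j + l) ω) ∂μ = e := fun j =>
      ((hs.identDistrib_block K (s + j)).comp hf).integral_eq
    simp [this]
  have he0 : 0 ≤ e := integral_nonneg fun _ => hf0 _
  have heC : e ≤ C := by
    have := integral_mono (by simpa using hbdd 0) (integrable_const C)
      fun ω => hfC (fun l => X l ω)
    simpa using this
  have hψ : 0 ≤ (psiStar μ X g).toReal - 1 := by
    have := ENNReal.toReal_mono hg (one_le_psiStar μ (X := X) g)
    simpa using this
  have hvar : variance Z μ ≤ N * (2 * (K + g) * C ^ 2) +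
      N ^ 2 * (((psiStar μ X g).toReal - 1) * C ^ 2) := by
    rw [variance_eq_sub hZL, hEZ]
    have h1 := integral_sq_sum_block_le μ hX hs hf hf0 hfC hg N s
    have h2 : e ^ 2 ≤ C ^ 2 := by gcongr
    have h3 : ((psiStar μ X g).toReal - 1) * e ^ 2 ≤ ((psiStar μ X g).toReal - 1) * C ^ 2 := by
      gcongr
    have h4 := mul_le_mul_of_nonneg_left h3 (sq_nonneg (N : ℝ))
    have h5 : μ[Z ^ 2] = ∫ ω, (∑ j ∈ Finset.range N, f (fun l => X (s + j + l) ω)) ^ 2 ∂μ := rfl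
    rw [h5]
    rw [← he] at h1
    linarith
  have hcheb := meas_ge_le_variance_div_sq hZL (c := N * ε) (by positivity)
  rw [measureReal_def]
  refine (ENNReal.toReal_mono (by simp) ((measure_mono fun ω hω => ?_).trans hcheb)).trans ?_
  · simp only [Set.mem_ofPred_eq] at hω ⊢
    rw [hEZ]
    refine le_trans ?_ (le_abs_self _)
    linarith
  · rw [ENNReal.toReal_ofReal (div_nonneg (variance_nonneg _ _) (by positivity))]
    refine (div_le_div_of_nonneg_right hvar (by positivity)).trans_eq ?_
    field_simp

/-- The function varies with `n`, so this is a weak law for a triangular array; uniform boundedness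
and a fixed block length make the Chebyshev bound uniform. -/
theorem tendsto_measure_sum_block_ge (hX : ∀ i, Measurable (X i)) (hs : IsStationary μ X)
    (hmix : IsPsiStarMixing μ X) {K : ℕ} {f : ℕ → (Fin K → ℝ) → ℝ} (hf : ∀ n, Measurable (f n))
    (hf0 : ∀ n x, 0 ≤ f n x) {C : ℝ} (hfC : ∀ n x, f n x ≤ C) {N : ℕ → ℕ}
    (hN : Tendsto N atTop atTop) (s : ℕ → ℕ) {ε : ℝ} (hε : 0 < ε) :
    Tendsto (fun n => μ {ω | N n * (∫ ω, f n (fun l => X l ω) ∂μ + ε) ≤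
        ∑ j ∈ Finset.range (N n), f n (fun l => X (s n + j + l) ω)}) atTop (𝓝 0) := by
  rw [← ENNReal.tendsto_toReal_iff (by simp) (by simp), ENNReal.toReal_zero,
    Metric.tendsto_atTop']
  intro η hη
  have h1 : Tendsto (fun g => ((psiStar μ X g).toReal - 1) * C ^ 2 / ε ^ 2) atTop (𝓝 0) := by
    have h := (ENNReal.tendsto_toReal ENNReal.one_ne_top).comp hmix
    have h' := ((h.sub_const 1).mul_const (C ^ 2)).div_const (ε ^ 2)
    simpa using h'
  -- The gap is fixed first, making the mixing defect small; only then does the number of blocks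
  -- grow, which removes the close pairs.
  obtain ⟨g, hg1, hg2⟩ := ((h1.eventually_lt_const (half_pos hη)).and
    (hmix.eventually_ne ENNReal.one_ne_top)).exists
  have h2 : Tendsto (fun n => 2 * (K + g) * C ^ 2 / ε ^ 2 / (N n : ℝ)) atTop (𝓝 0) :=
    (tendsto_natCast_atTop_atTop.comp hN).const_div_atTop _
  obtain ⟨n0, hn0⟩ := eventually_atTop.1
    ((h2.eventually_lt_const (half_pos hη)).and (hN.eventually_gt_atTop 0))
  refine ⟨n0, fun n hn => ?_⟩
  obtain ⟨h3, h4⟩ := hn0 n hn.le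
  rw [Real.dist_eq, sub_zero, abs_of_nonneg ENNReal.toReal_nonneg]
  have := measureReal_sum_block_ge_le μ hX hs (hf n) (hf0 n) (hfC n) hg2 h4 (s n) hε
  rw [measureReal_def] at this
  linarith

end Mixing

/-! ### Quantization error and alphabet size -/

section Quantization

theorem measurable_quantize (b : ℕ) : Measurable (quantize b) := by
  unfold quantize
  fun_prop

theorem quantize_le (b : ℕ) (x : ℝ) : quantize b x ≤ x := by
  rw [quantize, div_le_iff₀ (by positivity), mul_comm x]
  exact Int.floor_le _

theorem sub_quantize_le (b : ℕ) (x : ℝ) : x - quantize b x ≤ 1 / 2 ^ b := by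
  rw [quantize, sub_le_iff_le_add, ← add_div, le_div_iff₀ (by positivity), mul_comm x]
  linarith [Int.lt_floor_add_one ((2 : ℝ) ^ b * x)]

theorem exists_ncard_quantSet_le {S : Set ℝ} (hS : Bornology.IsBounded S) :
    ∃ D : ℝ, 1 ≤ D ∧ ∀ b, (quantSet b S).Finite ∧ ((quantSet b S).ncard : ℝ) ≤ D * 2 ^ b := by
  obtain ⟨R, hR⟩ := hS.exists_norm_le
  obtain ⟨M, hM⟩ := exists_nat_ge R
  refine ⟨2 * M + 1, by norm_cast; omega, fun b => ?_⟩
  have hsub : quantSet b S ⊆ ((Finset.Icc (-(2 ^ b * M : ℤ)) (2 ^ b * M)).image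
      fun z : ℤ => (z : ℝ) / 2 ^ b : Finset ℝ) := by
    rintro _ ⟨x, hx, rfl⟩
    rw [Finset.coe_image]
    refine ⟨⌊(2 : ℝ) ^ b * x⌋, ?_, rfl⟩
    have h1 := abs_le.1 ((hR x hx).trans hM)
    rw [Finset.mem_coe, Finset.mem_Icc]
    have h2 : (2 : ℝ) ^ b * -M ≤ 2 ^ b * x := by gcongr; exact h1.1
    have h3 : (2 : ℝ) ^ b * x ≤ 2 ^ b * M := by gcongr; exact h1.2
    constructor
    · rw [Int.le_floor]
      push_cast
      linarith
    · rw [← Int.cast_le (R := ℝ)]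
      refine (Int.floor_le _).trans ?_
      push_cast
      exact h3
  refine ⟨(Finset.finite_toSet _).subset hsub, ?_⟩
  have h1 := Set.ncard_le_ncard hsub (Finset.finite_toSet _)
  rw [Set.ncard_coe_finset] at h1
  have h2 : ((Finset.Icc (-(2 ^ b * M : ℤ)) (2 ^ b * M)).image
      fun z : ℤ => (z : ℝ) / 2 ^ b : Finset ℝ).card ≤ 2 * (2 ^ b * M) + 1 := by
    refine Finset.card_image_le.trans ?_
    rw [Int.card_Icc]
    have : (2 ^ b * M + 1 - -(2 ^ b * M) : ℤ) = ((2 * (2 ^ b * M) + 1 : ℕ) : ℤ) := by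
      push_cast; ring
    rw [this, Int.toNat_natCast]
  have h3 : ((quantSet b S).ncard : ℝ) ≤ 2 * (2 ^ b * M) + 1 := by exact_mod_cast h1.trans h2
  have h4 : (1 : ℝ) ≤ 2 ^ b := one_le_pow₀ one_le_two
  linarith

end Quantization

/-! ### Smoothed conditional law and its code length -/

section SmoothedKernel

variable {Ω : Type*} [MeasurableSpace Ω] (μ : Measure Ω) (X : ℕ → Ω → ℝ)

/-- The conditional law of `[X_{k+1}]_b` given `[X^k]_b`, averaged with the mass `1 / c`. -/
noncomputable def smoothKernel (k b : ℕ) (c : ℝ) (v : Fin k → ℝ) (x : ℝ) : ℝ :=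
  1 / 2 * (μ.real {ω | (fun i : Fin k => quantize b (X i ω)) = v ∧ quantize b (X k ω) = x} /
    μ.real {ω | (fun i : Fin k => quantize b (X i ω)) = v}) + 1 / (2 * c)

/-- The code length of the last coordinate of a block for `smoothKernel`. -/
noncomputable def smoothCode (k b : ℕ) (c : ℝ) (x : Fin (k + 1) → ℝ) : ℝ :=
  -Real.logb 2 (smoothKernel μ X k b c (fun i => quantize b (x i.castSucc))
    (quantize b (x (Fin.last k))))

variable (k b : ℕ) {c : ℝ}

theorem inv_le_smoothKernel (v : Fin k → ℝ) (x : ℝ) :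
    1 / (2 * c) ≤ smoothKernel μ X k b c v x :=
  le_add_of_nonneg_left (by positivity)

theorem smoothKernel_pos (hc : 1 ≤ c) (v : Fin k → ℝ) (x : ℝ) : 0 < smoothKernel μ X k b c v x :=
  lt_of_lt_of_le (by positivity) (inv_le_smoothKernel μ X k b v x)

/-- The code length factors through the integer floors of the scaled coordinates, and every function
on a countable discrete space is measurable. -/
theorem measurable_smoothCode : Measurable (smoothCode μ X k b c) := by
  have h1 : Measurable fun (x : Fin (k + 1) → ℝ) (i : Fin (k + 1)) => ⌊(2 : ℝ) ^ b * x i⌋ := by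
    fun_prop
  have h2 : Measurable fun z : Fin (k + 1) → ℤ =>
      -Real.logb 2 (smoothKernel μ X k b c (fun i => (z i.castSucc : ℝ) / 2 ^ b)
        ((z (Fin.last k) : ℝ) / 2 ^ b)) := measurable_of_countable _
  convert h2.comp h1 using 1
  ext x
  simp only [smoothCode, quantize, Function.comp_apply]

/-- This is the purpose of the smoothing: the uniform floor `1 / (2 c)` keeps the code length
bounded. With `c` of order `2 ^ b` the bound is linear in `b`, as the weak law needs after division
by `b`. -/
theorem smoothCode_le (hc : 1 ≤ c) (x : Fin (k + 1) → ℝ) :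
    smoothCode μ X k b c x ≤ 1 + Real.logb 2 c := by
  have h1 := Real.logb_le_logb_of_le one_lt_two (by positivity)
    (inv_le_smoothKernel μ X k b (c := c) (fun i => quantize b (x i.castSucc))
      (quantize b (x (Fin.last k))))
  rw [one_div, Real.logb_inv, Real.logb_mul two_ne_zero (by positivity),
    Real.logb_self_eq_one one_lt_two] at h1
  rw [smoothCode]
  linarith

variable [IsProbabilityMeasure μ]

theorem smoothKernel_le_one (hc : 1 ≤ c) (v : Fin k → ℝ) (x : ℝ) :
    smoothKernel μ X k b c v x ≤ 1 := by
  have h1 : μ.real {ω | (fun i : Fin k => quantize b (X i ω)) = v ∧ quantize b (X k ω) = x} /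
      μ.real {ω | (fun i : Fin k => quantize b (X i ω)) = v} ≤ 1 :=
    div_le_one_of_le₀ (measureReal_mono fun ω hω => hω.1) measureReal_nonneg
  have h2 : 1 / (2 * c) ≤ 1 / 2 := one_div_le_one_div_of_le two_pos (by linarith)
  rw [smoothKernel]
  linarith

theorem smoothCode_nonneg (hc : 1 ≤ c) (x : Fin (k + 1) → ℝ) : 0 ≤ smoothCode μ X k b c x :=
  neg_nonneg.2 (Real.logb_nonpos one_lt_two (smoothKernel_pos μ X k b hc _ _).le
    (smoothKernel_le_one μ X k b hc _ _))

variable {X}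

theorem sum_smoothKernel_le_one (hX : ∀ i, Measurable (X i)) (T : Set ℝ) [Fintype T]
    (hc : 1 ≤ c) (hT : Fintype.card T ≤ c)
    (v : Fin k → ℝ) : ∑ x : T, smoothKernel μ X k b c v x ≤ 1 := by
  have hmq : ∀ i, Measurable fun ω => quantize b (X i ω) := fun i =>
    (measurable_quantize b).comp (hX i)
  have hmV : Measurable fun ω (i : Fin k) => quantize b (X i ω) :=
    measurable_pi_lambda _ fun i => hmq i
  have h1 : ∑ x : T, μ.real {ω | (fun i : Fin k => quantize b (X i ω)) = v ∧
      quantize b (X k ω) = x} ≤ μ.real {ω | (fun i : Fin k => quantize b (X i ω)) = v} := by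
    rw [← measureReal_biUnion_finset]
    · refine measureReal_mono ?_
      intro ω hω
      simp only [Set.mem_iUnion] at hω
      obtain ⟨x, _, hx⟩ := hω
      exact hx.1
    · intro x _ y _ hxy
      refine Set.disjoint_left.2 fun ω h h' => hxy (Subtype.ext (h.2.symm.trans h'.2))
    · intro x _
      exact (hmV (measurableSet_singleton v)).inter ((hmq k) (measurableSet_singleton (x : ℝ)))
  have h2 : (∑ x : T, μ.real {ω | (fun i : Fin k => quantize b (X i ω)) = v ∧
      quantize b (X k ω) = x}) / μ.real {ω | (fun i : Fin k => quantize b (X i ω)) = v} ≤ 1 :=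
    div_le_one_of_le₀ h1 measureReal_nonneg
  have h3 : (Fintype.card T : ℝ) * (1 / (2 * c)) ≤ 1 / 2 := by
    rw [mul_one_div, div_le_iff₀ (by positivity)]
    linarith
  simp only [smoothKernel]
  rw [Finset.sum_add_distrib, ← Finset.mul_sum, ← Finset.sum_div, Finset.sum_const,
    Finset.card_univ, nsmul_eq_mul]
  linarith

/-- The expected code length exceeds the conditional entropy by at most one bit. -/
theorem ofReal_integral_smoothCode_le (hX : ∀ i, Measurable (X i)) {S : Set ℝ}
    (hXS : ∀ i ω, X i ω ∈ S) (hfin : (quantSet b S).Finite) (hc : 1 ≤ c) :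
    ENNReal.ofReal (∫ ω, smoothCode μ X k b c (fun l => X l ω) ∂μ) ≤ condEntropy μ
      (fun ω => quantize b (X k ω)) (fun ω (i : Fin k) => quantize b (X i ω)) + 1 := by
  have := hfin.fintype
  set Φ : Ω → Fin (k + 1) → quantSet b S := fun ω i =>
    ⟨quantize b (X i ω), Set.mem_image_of_mem _ (hXS i ω)⟩ with hΦ
  have hmΦ : Measurable Φ := measurable_pi_lambda _ fun i =>
    ((measurable_quantize b).comp (hX i)).subtype_mk
  set pj : (Fin k → ℝ) → ℝ → ℝ := fun v x =>
    μ.real {ω | (fun i : Fin k => quantize b (X i ω)) = v ∧ quantize b (X k ω) = x} with hpj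
  set pm : (Fin k → ℝ) → ℝ := fun v =>
    μ.real {ω | (fun i : Fin k => quantize b (X i ω)) = v} with hpm
  have hprob : IsProbabilityMeasure (μ.map Φ) := Measure.isProbabilityMeasure_map hmΦ.aemeasurable
  have hpt : ∀ a : Fin (k + 1) → quantSet b S,
      (μ.map Φ).real {a} = pj (fun i => (Fin.init a i : ℝ)) (a (Fin.last k)) := by
    intro a
    rw [map_measureReal_apply hmΦ (measurableSet_singleton a), hpj]
    congr 1
    ext ω
    simp only [Set.mem_preimage, Set.mem_singleton_iff, Set.mem_ofPred_eq, funext_iff, hΦ,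
      Fin.forall_fin_succ', Subtype.ext_iff, Fin.init, Fin.val_castSucc, Fin.val_last]
  have hint : ∫ ω, smoothCode μ X k b c (fun l => X l ω) ∂μ =
      ∑ v : Fin k → quantSet b S, ∑ x : quantSet b S, pj (fun i => v i) x *
        -Real.logb 2 (smoothKernel μ X k b c (fun i => v i) x) := by
    have h1 : ∫ ω, smoothCode μ X k b c (fun l => X l ω) ∂μ =
        ∫ a, -Real.logb 2 (smoothKernel μ X k b c (fun i => (Fin.init a i : ℝ))
          (a (Fin.last k))) ∂(μ.map Φ) := by
      rw [integral_map hmΦ.aemeasurable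
        (measurable_of_countable _).aestronglyMeasurable]
      rfl
    rw [h1, integral_fintype (Integrable.of_finite)]
    simp_rw [hpt, smul_eq_mul]
    exact sum_pi_fin_succ fun (v : Fin k → quantSet b S) (x : quantSet b S) =>
      pj (fun i => v i) x * -Real.logb 2 (smoothKernel μ X k b c (fun i => v i) x)
  have hpjpm : ∀ v x, pj v x ≤ pm v := fun v x => measureReal_mono fun ω hω => hω.1
  have hpj0 : ∀ v x, 0 ≤ pj v x := fun v x => measureReal_nonneg
  have hnn : ∀ v x, 0 ≤ pj v x * Real.logb 2 (pm v / pj v x) := by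
    intro v x
    rcases (hpj0 v x).eq_or_lt with h | h
    · rw [← h, zero_mul]
    · exact mul_nonneg h.le (Real.logb_nonneg one_lt_two ((one_le_div h).2 (hpjpm v x)))
  -- Discarding the uniform half of the mixture leaves half of the true conditional law; the factor
  -- `1 / 2` is the one extra bit.
  have hterm : ∀ v x, pj v x * -Real.logb 2 (smoothKernel μ X k b c v x) ≤
      pj v x * Real.logb 2 (pm v / pj v x) + pj v x := by
    intro v x
    rcases (hpj0 v x).eq_or_lt with h | h
    · rw [← h]; simp
    · have hm := h.trans_le (hpjpm v x)
      have h1 : 1 / 2 * (pj v x / pm v) ≤ smoothKernel μ X k b c v x :=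
        le_add_of_nonneg_right (by positivity)
      have h2 := Real.logb_le_logb_of_le one_lt_two (by positivity) h1
      rw [Real.logb_mul (by norm_num) (by positivity), one_div, Real.logb_inv,
        Real.logb_self_eq_one one_lt_two, Real.logb_div h.ne' hm.ne'] at h2
      rw [Real.logb_div hm.ne' h.ne', ← mul_add_one]
      exact mul_le_mul_of_nonneg_left (by linarith) h.le
  have hone : ∑ v : Fin k → quantSet b S, ∑ x : quantSet b S, pj (fun i => v i) x = 1 := by
    rw [← sum_pi_fin_succ fun (v : Fin k → quantSet b S) (x : quantSet b S) =>
      pj (fun i => v i) x]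
    simp_rw [← hpt]
    rw [sum_measureReal_singleton]
    simp
  have hsum : ∫ ω, smoothCode μ X k b c (fun l => X l ω) ∂μ ≤
      (∑ v : Fin k → quantSet b S, ∑ x : quantSet b S,
        pj (fun i => v i) x * Real.logb 2 (pm (fun i => v i) / pj (fun i => v i) x)) + 1 := by
    rw [hint, ← hone, ← Finset.sum_add_distrib]
    refine Finset.sum_le_sum fun v _ => ?_
    rw [← Finset.sum_add_distrib]
    exact Finset.sum_le_sum fun x _ => hterm _ _
  refine (ENNReal.ofReal_le_ofReal hsum).trans ?_
  rw [ENNReal.ofReal_add (Finset.sum_nonneg fun v _ => Finset.sum_nonneg fun x _ => hnn _ _)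
    zero_le_one, ENNReal.ofReal_one]
  gcongr
  rw [ENNReal.ofReal_sum_of_nonneg fun v _ => Finset.sum_nonneg fun x _ => hnn _ _]
  rw [condEntropy, ← tsum_fintype (L := .unconditional _)]
  -- The entropy sums over all real values; restricting to the finite alphabet drops only
  -- nonnegative terms.
  refine le_trans ?_ (ENNReal.tsum_comp_le_tsum_of_injective
    (f := fun (v : Fin k → quantSet b S) (i : Fin k) => (v i : ℝ))
    (fun v v' h => funext fun i => Subtype.ext (congrFun h i)) _)
  refine ENNReal.tsum_le_tsum fun v => ?_
  rw [ENNReal.ofReal_sum_of_nonneg fun x _ => hnn _ _, ← tsum_fintype (L := .unconditional _)]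
  exact ENNReal.tsum_comp_le_tsum_of_injective
    (f := fun x : quantSet b S => (x : ℝ)) Subtype.val_injective _

end SmoothedKernel

/-! ### Gaussian matrices applied to a fixed vector -/

section Gaussian

variable {Ω : Type*} [MeasurableSpace Ω] {μ : Measure Ω} [IsProbabilityMeasure μ]

/-- A linear combination of independent standard normal variables is normal. -/
theorem hasLaw_sum_mul_gaussianReal {ι : Type*} [Fintype ι] {a : ι → Ω → ℝ}
    (ha : ∀ i, HasLaw (a i) (gaussianReal 0 1) μ) (hind : iIndepFun a μ) (v : ι → ℝ) :
    HasLaw (fun ω => ∑ i, a i ω * v i) (gaussianReal 0 (∑ i, Real.toNNReal (v i ^ 2))) μ := by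
  have hm : ∀ i, AEMeasurable (fun ω => a i ω * v i) μ := fun i =>
    (ha i).aemeasurable.mul_const _
  refine ⟨Finset.aemeasurable_fun_sum _ fun i _ => hm i, ?_⟩
  have hsum : AEMeasurable (fun ω => ∑ i, a i ω * v i) μ :=
    Finset.aemeasurable_fun_sum _ fun i _ => hm i
  have := Measure.isProbabilityMeasure_map hsum
  refine Measure.ext_of_charFun ?_
  rw [iIndepFun.charFun_map_fun_sum_eq_prod hm
    (hind.comp (fun i x => x * v i) fun i => by fun_prop)]
  ext t
  rw [Finset.prod_apply, charFun_gaussianReal]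
  have h1 : ∀ i, charFun (μ.map fun ω => a i ω * v i) t =
      Complex.exp (-(((v i) ^ 2 : ℝ) * t ^ 2 / 2)) := by
    intro i
    rw [(gaussianReal_mul_const (ha i) (v i)).map_eq, charFun_gaussianReal]
    simp
  simp_rw [h1]
  rw [← Complex.exp_sum]
  congr 1
  simp only [Complex.ofReal_zero, mul_zero, zero_mul, zero_sub, NNReal.coe_sum,
    Real.coe_toNNReal _ (sq_nonneg _), Complex.ofReal_sum, Finset.sum_neg_distrib,
    Finset.sum_mul, Finset.sum_div]

variable {m n : ℕ} {a : Fin m × Fin n → Ω → ℝ}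

theorem hasLaw_row_mul (ha : ∀ p, HasLaw (a p) (gaussianReal 0 1) μ) (hind : iIndepFun a μ)
    (v : Fin n → ℝ) (i : Fin m) :
    HasLaw (fun ω => ∑ j, a (i, j) ω * v j) (gaussianReal 0 (∑ j, Real.toNNReal (v j ^ 2))) μ :=
  hasLaw_sum_mul_gaussianReal (fun j => ha (i, j))
    (hind.precomp (g := fun j => (i, j)) fun _ _ h => (Prod.mk.inj h).2) v

/-- The coordinates of `A v` are independent for a standard Gaussian matrix `A`. -/
theorem iIndepFun_row_mul (ha : ∀ p, HasLaw (a p) (gaussianReal 0 1) μ) (hind : iIndepFun a μ)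
    (v : Fin n → ℝ) : iIndepFun (fun (i : Fin m) ω => ∑ j, a (i, j) ω * v j) μ := by
  have hm : ∀ i, AEMeasurable (fun ω => ∑ j, a (i, j) ω * v j) μ := fun i =>
    (hasLaw_row_mul ha hind v i).aemeasurable
  rw [iIndepFun_iff_charFun_pi hm]
  intro t
  have h1 := hasLaw_sum_mul_gaussianReal ha hind fun p => t p.1 * v p.2
  -- The joint characteristic function of `A v` at `t` is that of the single linear combination with
  -- coefficients `t i * v j`, evaluated at `1`; its exponent splits over the rows.
  have h2 : charFun (μ.map fun ω => WithLp.toLp 2 fun i : Fin m => ∑ j, a (i, j) ω * v j) t =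
      charFun (μ.map fun ω => ∑ p : Fin m × Fin n, a p ω * (t p.1 * v p.2)) 1 := by
    rw [charFun_apply, charFun_apply, integral_map (by fun_prop) (by fun_prop),
      integral_map h1.aemeasurable (by fun_prop)]
    refine integral_congr_ae (Eventually.of_forall fun ω => ?_)
    simp only [PiLp.inner_apply, RCLike.inner_apply, conj_trivial, Fintype.sum_prod_type,
      Finset.mul_sum, one_mul]
    congr 4
    ext i
    exact Finset.sum_congr rfl fun j _ => by ring
  rw [h2, h1.map_eq, charFun_gaussianReal]
  simp_rw [(hasLaw_row_mul ha hind v _).map_eq, charFun_gaussianReal]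
  rw [← Complex.exp_sum]
  congr 1
  simp only [Complex.ofReal_zero, mul_zero, zero_mul, zero_sub, NNReal.coe_sum,
    Real.coe_toNNReal _ (sq_nonneg _), Complex.ofReal_sum, Finset.sum_neg_distrib,
    Fintype.sum_prod_type, Complex.ofReal_one, one_pow, mul_one, Finset.sum_mul, Finset.sum_div]
  congr 1
  refine Finset.sum_congr rfl fun i _ => Finset.sum_congr rfl fun j _ => ?_
  push_cast
  ring

theorem integral_exp_neg_mul_sq_gaussianReal {v : ℝ≥0} (hv : v ≠ 0) {t : ℝ} (ht : 0 ≤ t) :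
    ∫ x, Real.exp (-t * x ^ 2) ∂(gaussianReal 0 v) = (√(1 + 2 * t * v))⁻¹ := by
  have hv' : (0 : ℝ) < v := by positivity
  rw [integral_gaussianReal_eq_integral_smul hv]
  have h1 : ∀ x : ℝ, gaussianPDFReal 0 v x • Real.exp (-t * x ^ 2) =
      (√(2 * Real.pi * v))⁻¹ * Real.exp (-(t + 1 / (2 * v)) * x ^ 2) := by
    intro x
    rw [gaussianPDFReal, smul_eq_mul, mul_assoc, ← Real.exp_add]
    congr 2
    field_simp
    ring
  simp_rw [h1]
  rw [integral_const_mul, integral_gaussian, ← Real.sqrt_inv, ← Real.sqrt_inv,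
    ← Real.sqrt_mul (by positivity)]
  congr 1
  have := Real.pi_pos
  field_simp
  ring

/-- Lower tail of `‖A v‖²` for a standard Gaussian matrix `A`. -/
theorem measureReal_sum_sq_le (ha : ∀ p, HasLaw (a p) (gaussianReal 0 1) μ)
    (hind : iIndepFun a μ) {v : Fin n → ℝ} (hv : 0 < ∑ j, v j ^ 2) {σ : ℝ} (hσ : 0 < σ) :
    μ.real {ω | ∑ i : Fin m, (∑ j, a (i, j) ω * v j) ^ 2 ≤ σ ^ 2 * m * ∑ j, v j ^ 2} ≤
      (Real.exp (1 / 2) * σ) ^ m := by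
  set s := ∑ j, v j ^ 2 with hs
  set V : ℝ≥0 := ∑ j, Real.toNNReal (v j ^ 2) with hV
  have hVs : (V : ℝ) = s := by
    rw [hV, hs, NNReal.coe_sum]
    exact Finset.sum_congr rfl fun j _ => Real.coe_toNNReal _ (sq_nonneg _)
  have hV0 : V ≠ 0 := fun h => by rw [h] at hVs; simp [← hVs] at hv
  -- Near-optimal Chernoff parameter: the exponential factor becomes `e ^ (m / 2)`, and `2 t s =
  -- σ⁻²` bounds each factor of the transform by `σ`.
  set t : ℝ := 1 / (2 * σ ^ 2 * s) with ht
  have ht0 : 0 < t := by positivity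
  have hlaw := hasLaw_row_mul ha hind v
  have hsq : ∀ i, AEMeasurable (fun ω => (∑ j, a (i, j) ω * v j) ^ 2) μ := fun i =>
    (hlaw i).aemeasurable.pow_const 2
  have hmgf : mgf (∑ i : Fin m, fun ω => (∑ j, a (i, j) ω * v j) ^ 2) μ (-t) =
      ((√(1 + 2 * t * s))⁻¹) ^ m := by
    have hsqind : iIndepFun (fun (i : Fin m) ω => (∑ j, a (i, j) ω * v j) ^ 2) μ :=
      (iIndepFun_row_mul ha hind v).comp (fun _ x => x ^ 2) fun _ => by fun_prop
    rw [hsqind.mgf_sum₀ hsq]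
    have : ∀ i, mgf (fun ω => (∑ j, a (i, j) ω * v j) ^ 2) μ (-t) = (√(1 + 2 * t * s))⁻¹ := by
      intro i
      rw [mgf, ← hVs, ← integral_exp_neg_mul_sq_gaussianReal hV0 ht0.le, ← (hlaw i).map_eq,
        integral_map (hlaw i).aemeasurable (by fun_prop)]
    simp [this]
  have hint : Integrable (fun ω => Real.exp (-t *
      (∑ i : Fin m, fun ω => (∑ j, a (i, j) ω * v j) ^ 2) ω)) μ := by
    refine Integrable.of_bound ?_ 1 (Eventually.of_forall fun ω => ?_)
    · exact ((Finset.aemeasurable_sum _ fun i _ => hsq i).const_mul _).exp.aestronglyMeasurable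
    · rw [Real.norm_of_nonneg (Real.exp_nonneg _), Real.exp_le_one_iff, Finset.sum_apply]
      exact mul_nonpos_of_nonpos_of_nonneg (by linarith) (Finset.sum_nonneg fun i _ => sq_nonneg _)
  have h := measure_le_le_exp_mul_mgf (σ ^ 2 * m * s) (neg_nonpos.2 ht0.le) hint
  simp only [Finset.sum_apply] at h
  refine h.trans ?_
  rw [hmgf, mul_pow]
  have h1 : - -t * (σ ^ 2 * m * s) = m * (1 / 2) := by
    rw [ht]; field_simp
  rw [h1, Real.exp_nat_mul]
  gcongr
  rw [inv_le_comm₀ (by positivity) hσ]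
  refine Real.le_sqrt_of_sq_le ?_
  rw [ht, inv_pow]
  have : 2 * (1 / (2 * σ ^ 2 * s)) * s = (σ ^ 2)⁻¹ := by field_simp
  rw [this]
  linarith

/-- The mean of `‖A v‖²` for a standard Gaussian matrix `A`. -/
theorem lintegral_sum_sq (ha : ∀ p, HasLaw (a p) (gaussianReal 0 1) μ)
    (hind : iIndepFun a μ) (v : Fin n → ℝ) :
    ∫⁻ ω, ENNReal.ofReal (∑ i : Fin m, (∑ j, a (i, j) ω * v j) ^ 2) ∂μ =
      ENNReal.ofReal (m * ∑ j, v j ^ 2) := by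
  have hlaw := hasLaw_row_mul ha hind v
  have h1 : ∀ i, ∫⁻ ω, ENNReal.ofReal ((∑ j, a (i, j) ω * v j) ^ 2) ∂μ =
      ENNReal.ofReal (∑ j, v j ^ 2) := by
    intro i
    have h2 := (memLp_id_gaussianReal (μ := 0) (v := ∑ j, Real.toNNReal (v j ^ 2)) 2)
    have h3 := h2.ofReal_variance_eq
    rw [evariance_eq_lintegral_ofReal, variance_id_gaussianReal] at h3
    simp only [id_eq, integral_id_gaussianReal, sub_zero] at h3
    rw [← (hlaw i).map_eq, lintegral_map' (by fun_prop) (hlaw i).aemeasurable] at h3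
    rw [← h3, NNReal.coe_sum]
    congr 1
    exact Finset.sum_congr rfl fun j _ => Real.coe_toNNReal _ (sq_nonneg _)
  simp_rw [ENNReal.ofReal_sum_of_nonneg fun (i : Fin m) _ => sq_nonneg _]
  rw [lintegral_finsetSum']
  · simp_rw [h1]
    rw [ENNReal.ofReal_mul (by positivity)]
    simp
  · exact fun i _ => ((hlaw i).aemeasurable.pow_const 2).ennreal_ofReal

/-- A bound that holds for every fixed value of `Y` also holds for `Y` independent of `Z`. -/
theorem lintegral_indep_le {β γ : Type*} [MeasurableSpace β] [MeasurableSpace γ] {Z : Ω → β}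
    {Y : Ω → γ} (hZ : AEMeasurable Z μ) (hY : AEMeasurable Y μ) (hZY : IndepFun Z Y μ)
    {g : β → γ → ℝ≥0∞} (hg : Measurable (Function.uncurry g)) {p : ℝ≥0∞}
    (h : ∀ ω', ∫⁻ ω, g (Z ω) (Y ω') ∂μ ≤ p) : ∫⁻ ω, g (Z ω) (Y ω) ∂μ ≤ p := by
  have := Measure.isProbabilityMeasure_map hY
  have := Measure.isProbabilityMeasure_map hZ
  have h1 : ∫⁻ ω, g (Z ω) (Y ω) ∂μ =
      ∫⁻ y, ∫⁻ z, g z y ∂(μ.map Z) ∂(μ.map Y) := by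
    rw [← lintegral_prod_symm' (fun z : β × γ => g z.1 z.2) hg,
      ← hZY.map_prod_eq_prod_map_map hZ hY]
    exact (lintegral_map' (f := Function.uncurry g) hg.aemeasurable (hZ.prodMk hY)).symm
  rw [h1, lintegral_map' (Measurable.lintegral_prod_left hg).aemeasurable hY]
  calc _ ≤ ∫⁻ _ω, p ∂μ := lintegral_mono fun ω' => by
        rw [lintegral_map' (f := fun z => g z (Y ω'))
          (hg.comp measurable_prodMk_right).aemeasurable hZ]
        exact h ω'
    _ = p := by simp

end Gaussian

/-! ### Growth of the parameters -/

section Asymptotics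

theorem tendsto_logb_natCast : Tendsto (fun n : ℕ => Real.logb 2 n) atTop atTop :=
  (Real.tendsto_logb_atTop one_lt_two).comp tendsto_natCast_atTop_atTop

theorem tendsto_bits {r : ℝ} (hr : 0 < r) : Tendsto (bits r) atTop atTop :=
  tendsto_nat_floor_atTop.comp
    (((Real.tendsto_logb_atTop one_lt_two).comp tendsto_logb_natCast).const_mul_atTop hr)

theorem eventually_two_pow_bits {r : ℝ} (hr : 0 < r) : ∀ᶠ n : ℕ in atTop,
    (bits r n : ℝ) ≤ r * Real.logb 2 (Real.logb 2 n) ∧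
    ((2 : ℝ) ^ bits r n) ^ 2 ≤ regParam r n ∧ regParam r n ≤ 4 * ((2 : ℝ) ^ bits r n) ^ 2 := by
  filter_upwards [tendsto_logb_natCast.eventually_gt_atTop 1] with n hn
  have hL : 0 < Real.logb 2 (n : ℝ) := zero_lt_one.trans hn
  have hLL : 0 < Real.logb 2 (Real.logb 2 n) := Real.logb_pos one_lt_two hn
  have h1 : (bits r n : ℝ) ≤ r * Real.logb 2 (Real.logb 2 n) := Nat.floor_le (by positivity)
  have h2 : r * Real.logb 2 (Real.logb 2 n) ≤ bits r n + 1 := (Nat.lt_floor_add_one _).le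
  have h3 : regParam r n = ((2 : ℝ) ^ (r * Real.logb 2 (Real.logb 2 n))) ^ 2 := by
    rw [regParam, mul_comm r, Real.rpow_mul two_pos.le, Real.rpow_logb two_pos (by norm_num) hL,
      ← Real.rpow_natCast, ← Real.rpow_mul hL.le, mul_comm]
    norm_num
  refine ⟨h1, ?_, ?_⟩
  · rw [h3, ← Real.rpow_natCast 2 (bits r n)]
    gcongr
    exact one_le_two
  · rw [h3]
    calc ((2 : ℝ) ^ (r * Real.logb 2 (Real.logb 2 n))) ^ 2
        ≤ ((2 : ℝ) ^ ((bits r n : ℝ) + 1)) ^ 2 := by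
          gcongr
          exact one_le_two
      _ = _ := by
          rw [Real.rpow_add two_pos, Real.rpow_natCast, Real.rpow_one]
          ring

/-- The base-2 logarithm of the left side is at most `2 r (k + 1) log log n`, which is `o(log n)`.
Thus the number of possible blocks is sublinear in `n`. -/
theorem eventually_alphabet_pow_le {r D : ℝ} (hr : 0 < r) (hD : 1 ≤ D) {k : ℕ → ℕ}
    (hko : (fun n : ℕ => (k n : ℝ)) =o[atTop]
      fun n : ℕ => Real.logb 2 n / Real.logb 2 (Real.logb 2 n)) :
    ∀ᶠ n : ℕ in atTop, (D * 2 ^ bits r n) ^ (k n + 1) ≤ √(n : ℝ) := by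
  have hLL := (Real.tendsto_logb_atTop one_lt_two).comp tendsto_logb_natCast
  -- With this constant for both `k` and the extra `1` in `k + 1`, the exponent is at most `2 r * 2
  -- / (8 r) = 1 / 2` times `log n`.
  have hε : 0 < 1 / (8 * r) := by positivity
  have hsmall : ∀ᶠ n : ℕ in atTop, Real.logb 2 (Real.logb 2 n) ≤
      1 / (8 * r) * Real.logb 2 n := by
    have h := (Real.isLittleO_log_id_atTop.bound
      (c := 1 / (8 * r) * Real.log 2) (by positivity))
    filter_upwards [tendsto_logb_natCast.eventually h,
      tendsto_logb_natCast.eventually_gt_atTop 1] with n h1 h2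
    rw [Real.norm_of_nonneg (Real.log_nonneg h2.le), id, Real.norm_of_nonneg (by linarith)] at h1
    rw [Real.logb, div_le_iff₀ (Real.log_pos one_lt_two)]
    linarith
  filter_upwards [eventually_two_pow_bits hr, hko.bound hε, hsmall,
    tendsto_logb_natCast.eventually_gt_atTop 1,
    hLL.eventually_ge_atTop (max 1 (Real.logb 2 D / r)), eventually_gt_atTop 0]
    with n hb hk hs hL hl hn
  simp only [Function.comp_apply] at hl
  set l := Real.logb 2 (Real.logb 2 n) with hl_def
  set L := Real.logb 2 (n : ℝ) with hL_def
  have hl0 : 0 < l := lt_of_lt_of_le zero_lt_one ((le_max_left _ _).trans hl)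
  have hL0 : 0 < L := by linarith
  have hDl : Real.logb 2 D ≤ r * l := by
    rw [← div_le_iff₀' hr]
    exact (le_max_right _ _).trans hl
  rw [Real.norm_natCast, Real.norm_of_nonneg (by positivity)] at hk
  have hk1 : ((k n : ℝ) + 1) * l ≤ 2 * (1 / (8 * r) * L) := by
    have : (k n : ℝ) * l ≤ 1 / (8 * r) * L := by
      rw [← mul_div_assoc, le_div_iff₀ hl0] at hk
      exact hk
    linarith
  have hD0 : 0 < D := by linarith
  have hbase : D * 2 ^ bits r n = 2 ^ (Real.logb 2 D + bits r n) := by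
    rw [Real.rpow_add two_pos, Real.rpow_logb two_pos (by norm_num) hD0, Real.rpow_natCast]
  have hsqrt : √(n : ℝ) = 2 ^ (L * (1 / 2)) := by
    rw [Real.rpow_mul two_pos.le, hL_def, Real.rpow_logb two_pos (by norm_num) (by positivity),
      Real.sqrt_eq_rpow]
  rw [hbase, hsqrt, ← Real.rpow_natCast, ← Real.rpow_mul two_pos.le]
  refine Real.rpow_le_rpow_of_exponent_le one_le_two ?_
  push_cast
  calc (Real.logb 2 D + bits r n) * ((k n : ℝ) + 1) ≤ (2 * (r * l)) * ((k n : ℝ) + 1) := by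
        gcongr
        linarith [hb.1]
    _ = 2 * r * (((k n : ℝ) + 1) * l) := by ring
    _ ≤ 2 * r * (2 * (1 / (8 * r) * L)) := by gcongr
    _ = L * (1 / 2) := by field_simp; norm_num

/-- Since `√n log n = o(n)`, the number of tables of counts is subexponential; a linear number of
measurements absorbs it. -/
theorem eventually_pow_mul_le {c : ℝ} (hc : 0 < c) : ∀ᶠ n : ℕ in atTop,
    ∀ M : ℕ, (M : ℝ) ≤ √(n : ℝ) → ((n : ℝ) + 1) ^ M * M ≤ 2 ^ (c * n) := by
  have hl2 := Real.log_pos one_lt_two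
  have h := (isLittleO_log_rpow_atTop (r := 1 / 2) (by norm_num)).bound
    (c := c * Real.log 2 / 4) (by positivity)
  have ht : Tendsto (fun n : ℕ => (n : ℝ) + 1) atTop atTop :=
    tendsto_atTop_add_const_right _ _ tendsto_natCast_atTop_atTop
  filter_upwards [ht.eventually h, eventually_ge_atTop 1] with n hlog hn M hM
  have hn1 : (1 : ℝ) ≤ n := by exact_mod_cast hn
  set y : ℝ := (n : ℝ) + 1 with hy
  have hy1 : 1 ≤ y := by linarith
  rw [Real.norm_of_nonneg (Real.log_nonneg hy1), Real.norm_of_nonneg (by positivity),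
    ← Real.sqrt_eq_rpow] at hlog
  have hy2 : √y * √y = y := Real.mul_self_sqrt (by linarith)
  have hsy : 1 ≤ √y := Real.one_le_sqrt.2 hy1
  have hMy : (M : ℝ) ≤ √y := hM.trans (Real.sqrt_le_sqrt (by linarith))
  have hM2 : (M : ℝ) ≤ y := by nlinarith
  calc y ^ M * M ≤ y ^ M * y := by gcongr
    _ = y ^ ((M : ℝ) + 1) := by rw [Real.rpow_add (by linarith), Real.rpow_natCast, Real.rpow_one]
    _ = 2 ^ (Real.logb 2 y * ((M : ℝ) + 1)) := by
        rw [Real.rpow_mul two_pos.le, Real.rpow_logb two_pos (by norm_num) (by linarith)]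
    _ ≤ 2 ^ (c * n) := by
        refine Real.rpow_le_rpow_of_exponent_le one_le_two ?_
        rw [Real.logb, div_mul_eq_mul_div, div_le_iff₀ hl2]
        calc Real.log y * ((M : ℝ) + 1) ≤ (c * Real.log 2 / 4 * √y) * (2 * √y) := by
              gcongr
              linarith
          _ = c * Real.log 2 / 2 * y := by linear_combination (c * Real.log 2 / 2) * hy2
          _ ≤ c * n * Real.log 2 := by
              have : y ≤ 2 * n := by linarith
              have := mul_le_mul_of_nonneg_left this (by positivity : 0 ≤ c * Real.log 2 / 2)
              linarith

theorem eventually_succ_le_half {r D : ℝ} (hr : 0 < r) (hD : 1 ≤ D) {k : ℕ → ℕ}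
    (hko : (fun n : ℕ => (k n : ℝ)) =o[atTop]
      fun n : ℕ => Real.logb 2 n / Real.logb 2 (Real.logb 2 n)) :
    ∀ᶠ n : ℕ in atTop, 2 * (k n + 1) ≤ n := by
  filter_upwards [eventually_alphabet_pow_le hr hD hko, (tendsto_bits hr).eventually_ge_atTop 1,
    eventually_ge_atTop 4] with n h hb hn
  have h1 : (2 : ℝ) ≤ D * 2 ^ bits r n := by
    have : (2 : ℝ) ^ 1 ≤ 2 ^ bits r n := pow_le_pow_right₀ one_le_two hb
    nlinarith
  have h2 : ((k n + 1 : ℕ) : ℝ) ≤ √(n : ℝ) := by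
    calc ((k n + 1 : ℕ) : ℝ) ≤ (2 : ℝ) ^ (k n + 1) := by
          exact_mod_cast (Nat.lt_two_pow_self (n := k n + 1)).le
      _ ≤ _ := (pow_le_pow_left₀ two_pos.le h1 _).trans h
  have hs : √(n : ℝ) * √(n : ℝ) = n := Real.mul_self_sqrt (by positivity)
  have h4 : 2 ≤ √(n : ℝ) := Real.le_sqrt_of_sq_le (by norm_num; exact_mod_cast hn)
  have h5 : (2 * (k n + 1 : ℕ) : ℝ) ≤ n := by nlinarith
  exact_mod_cast h5

end Asymptotics

/-! ### Cost of the quantized source -/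

section SourceCost

variable {Ω : Type*} [MeasurableSpace Ω] (μ : Measure Ω) [IsProbabilityMeasure μ]
  {S : Set ℝ} {X : ℕ → Ω → ℝ}

/-- The cost of `[X^n]_b` for the weights `-log₂` of a kernel of lower order `k₀ ≤ k`. -/
theorem linCost_smoothKernel_le (hXS : ∀ i ω, X i ω ∈ S) {n k k₀ b : ℕ} (hk : k₀ ≤ k)
    (hn : k + 1 < n) {c : ℝ} (hc : 1 ≤ c) (hfin : (quantSet b S).Finite) (ω : Ω) {t : ℝ}
    (h : ∑ j ∈ Finset.range (n - (k + 1)),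
      smoothCode μ X k₀ b c (fun l => X (k - k₀ + j + l) ω) ≤ (n - (k + 1) : ℕ) * t) :
    linCost (fun a : Fin (k + 1) → quantSet b S => ENNReal.ofReal (-Real.logb 2
      (smoothKernel μ X k₀ b c (fun i : Fin k₀ => Fin.init a ⟨k - k₀ + i, by omega⟩)
        (a (Fin.last k)))))
      (quantVec b (fun i : Fin n => X i ω) fun i => hXS i ω) ≤ ENNReal.ofReal t := by
  have := hfin.to_subtype
  rw [linCost_eq_sum_window]
  have hN : ((n - (k + 1) : ℕ) : ℝ≥0∞) ≠ 0 := Nat.cast_ne_zero.2 (by omega)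
  rw [ENNReal.div_le_iff hN (by simp), mul_comm, ← ENNReal.ofReal_natCast (n - (k + 1)),
    ← ENNReal.ofReal_mul (by positivity)]
  refine le_trans (le_of_eq ?_) (ENNReal.ofReal_le_ofReal h)
  rw [ENNReal.ofReal_sum_of_nonneg fun j _ => smoothCode_nonneg μ X k₀ b hc _,
    ← Fin.sum_univ_eq_sum_range fun j => ENNReal.ofReal
      (smoothCode μ X k₀ b c (fun l => X (k - k₀ + j + l) ω))]
  refine Finset.sum_congr rfl fun j _ => ?_
  congr 1
  simp only [smoothCode, window, quantVec, Fin.init, Fin.val_castSucc, Fin.val_last]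
  congr 3
  · ext i
    congr 2
    omega
  · congr 2
    omega

/-- The limit superior bounds the entropy by `b d` for large `b`, and the extra bit of the smoothing
is at most `b e` once `b ≥ 1 / e`. -/
theorem eventually_integral_smoothCode_le (hX : ∀ i, Measurable (X i))
    (hXS : ∀ i ω, X i ω ∈ S) (hfin : ∀ b, (quantSet b S).Finite) {c : ℕ → ℝ} (hc : ∀ b, 1 ≤ c b)
    {k : ℕ} {d : ℝ} (hd : upperInfoDimOrder μ X k < ENNReal.ofReal d) {e : ℝ} (he : 0 < e) :
    ∀ᶠ b : ℕ in atTop, ∫ ω, smoothCode μ X k b (c b) (fun l => X l ω) ∂μ ≤ b * (d + e) := by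
  have hd0 : 0 < d := ENNReal.ofReal_pos.1 (bot_lt_of_lt hd)
  filter_upwards [eventually_lt_of_limsup_lt hd, eventually_ge_atTop ⌈1 / e⌉₊,
    eventually_gt_atTop 0] with b h1 h2 h3
  have hb : (0 : ℝ) < b := by exact_mod_cast h3
  have h4 : 1 ≤ b * e := by
    rw [← div_le_iff₀ he]
    exact (Nat.le_ceil _).trans (by exact_mod_cast h2)
  have h5 := ofReal_integral_smoothCode_le μ k b (c := c b) hX hXS (hfin b) (hc b)
  have h6 := (ENNReal.div_le_iff (Nat.cast_ne_zero.2 h3.ne') (by simp)).1 h1.le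
  have h7 := h5.trans (add_le_add_left h6 1)
  rw [← ENNReal.ofReal_natCast b, ← ENNReal.ofReal_mul hd0.le, ← ENNReal.ofReal_one,
    ← ENNReal.ofReal_add (by positivity) zero_le_one,
    ENNReal.ofReal_le_ofReal_iff (by positivity)] at h7
  linarith

/-- With high probability the cost of the quantized source is at most `b d'`, for any `d'` above
the information dimension. -/
theorem tendsto_measure_linCost_quantVec (hS : Bornology.IsBounded S)
    (hXmeas : ∀ i, Measurable (X i)) (hXS : ∀ i ω, X i ω ∈ S) (hstat : IsStationary μ X)
    (hmix : IsPsiStarMixing μ X) {d : ℝ≥0} (hd : IsUpperInfoDim μ X d) {r : ℝ} (hr : 0 < r)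
    {k : ℕ → ℕ} (hk : Tendsto k atTop atTop) (hkn : ∀ᶠ n : ℕ in atTop, 2 * (k n + 1) ≤ n)
    (q : ∀ n : ℕ, Ω → PMF (Fin (k n + 1) → quantSet (bits r n) S))
    (κ : ∀ n : ℕ, Ω → (Fin (k n) → quantSet (bits r n) S) → quantSet (bits r n) S → ℝ≥0∞)
    (hκ : ∀ n ω, IsCondProb (q n ω) (κ n ω))
    (hKL : ∀ ε : ℝ, 0 < ε → Tendsto (fun n : ℕ => μ {ω | ENNReal.ofReal ε <
      klBits (quantVec (bits r n) (fun i : Fin n => X i ω) (fun i => hXS i ω))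
        (q n ω) / (bits r n : ℝ≥0∞)}) atTop (𝓝 0))
    {d' : ℝ} (hd' : (d : ℝ) < d') :
    Tendsto (fun n : ℕ => μ {ω | ENNReal.ofReal (bits r n * d') <
      linCost (fun a => negLogTwo (κ n ω (Fin.init a) (a (Fin.last (k n)))))
        (quantVec (bits r n) (fun i : Fin n => X i ω) fun i => hXS i ω)}) atTop (𝓝 0) := by
  obtain ⟨D, hD, hcard⟩ := exists_ncard_quantSet_le hS
  -- The gap is spent in four parts: the choice of `k₀`, the smoothing bit, the deviation in the
  -- weak law, and the divergence.
  set e := (d' - d) / 4 with he_def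
  have he : 0 < e := by rw [he_def]; linarith
  have hd0 : (0 : ℝ) ≤ d := d.2
  have hlt : (d : ℝ≥0∞) < ENNReal.ofReal (d + e) := by
    rw [← ENNReal.ofReal_coe_nnreal]
    exact (ENNReal.ofReal_lt_ofReal_iff (by linarith)).2 (by linarith)
  -- The order is frozen here: the weak law needs a fixed block length, whereas `k n` tends to
  -- infinity.
  obtain ⟨k₀, hk₀⟩ := (hd.eventually_lt_const hlt).exists
  have hc : ∀ b : ℕ, 1 ≤ D * 2 ^ b := fun b =>
    one_le_mul_of_one_le_of_one_le hD (one_le_pow₀ one_le_two)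
  set f : ℕ → (Fin (k₀ + 1) → ℝ) → ℝ := fun n x =>
    smoothCode μ X k₀ (bits r n) (D * 2 ^ bits r n) x / bits r n with hf
  have hfC : ∀ n x, f n x ≤ 2 + Real.logb 2 D := by
    intro n x
    have hlD : 0 ≤ Real.logb 2 D := Real.logb_nonneg one_lt_two hD
    rcases Nat.eq_zero_or_pos (bits r n) with h0 | h0
    · simp only [hf, h0, Nat.cast_zero, div_zero]
      linarith
    · have hb1 : (1 : ℝ) ≤ bits r n := by exact_mod_cast h0
      rw [hf, div_le_iff₀ (by linarith)]
      refine (smoothCode_le μ X k₀ _ (hc _) x).trans ?_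
      rw [Real.logb_mul (by linarith) (by positivity), Real.logb_pow,
        Real.logb_self_eq_one one_lt_two]
      nlinarith
  have hN : Tendsto (fun n : ℕ => n - (k n + 1)) atTop atTop := by
    refine tendsto_atTop_mono' atTop (f₁ := fun n : ℕ => n / 2) ?_
      (Nat.tendsto_div_const_atTop two_ne_zero)
    filter_upwards [hkn] with n hn
    omega
  -- The starting shift `k n - k₀` selects the last `k₀ + 1` symbols of each window of length `k n +
  -- 1`.
  have hlln := tendsto_measure_sum_block_ge μ hXmeas hstat hmix (f := f)
    (fun n => (measurable_smoothCode μ X k₀ _).div_const _)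
    (fun n x => div_nonneg (smoothCode_nonneg μ X k₀ _ (hc _) x) (Nat.cast_nonneg _))
    hfC hN (fun n => k n - k₀) he
  refine tendsto_of_tendsto_of_tendsto_of_le_of_le' tendsto_const_nhds
    (by simpa using (hKL e he).add hlln) (Eventually.of_forall fun _ => zero_le) ?_
  filter_upwards [hkn, hk.eventually_ge_atTop k₀, (tendsto_bits hr).eventually_gt_atTop 0,
    (tendsto_bits hr).eventually (eventually_integral_smoothCode_le μ hXmeas hXS
      (fun b => (hcard b).1) hc hk₀ he), eventually_gt_atTop 2] with n hn hkk hb hint hn2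
  refine (measure_mono fun ω hω => ?_).trans (measure_union_le _ _)
  by_contra hcon
  simp only [Set.mem_union, Set.mem_ofPred_eq, not_or, not_lt, not_le] at hcon hω
  obtain ⟨h1, h2⟩ := hcon
  have hb0 : (0 : ℝ) < bits r n := by exact_mod_cast hb
  have hfin := (hcard (bits r n)).1
  have := hfin.fintype
  have hTc : (Fintype.card (quantSet (bits r n) S) : ℝ) ≤ D * 2 ^ bits r n := by
    rw [← Nat.card_eq_fintype_card, Nat.card_coe_set_eq]
    exact (hcard _).2
  have h3 := (ENNReal.div_le_iff (Nat.cast_ne_zero.2 hb.ne') (by simp)).1 h1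
  rw [← ENNReal.ofReal_natCast (bits r n), ← ENNReal.ofReal_mul he.le] at h3
  have hfint : ∫ ω, f n (fun l => X l ω) ∂μ ≤ d + 2 * e := by
    simp only [hf]
    rw [integral_div, div_le_iff₀ hb0]
    linarith
  have hcode : ∑ j ∈ Finset.range (n - (k n + 1)), smoothCode μ X k₀ (bits r n)
      (D * 2 ^ bits r n) (fun l => X (k n - k₀ + j + l) ω) ≤
      (n - (k n + 1) : ℕ) * (bits r n * (d + 3 * e)) := by
    have h4 := h2.le.trans (mul_le_mul_of_nonneg_left
      (add_le_add_left hfint e) (Nat.cast_nonneg (n - (k n + 1))))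
    simp only [hf] at h4
    rw [← Finset.sum_div, div_le_iff₀ hb0] at h4
    linarith
  have h5 := linCost_smoothKernel_le μ hXS hkk (by omega) (hc _) hfin ω hcode
  have hkn1 : k n + 1 < n := by omega
  have hidx : ∀ i : Fin k₀, k n - k₀ + i < k n := fun i => by omega
  have hQ1 : ∀ v : Fin (k n) → quantSet (bits r n) S, ∑ x : quantSet (bits r n) S,
      smoothKernel μ X k₀ (bits r n) (D * 2 ^ bits r n)
        (fun i : Fin k₀ => v ⟨k n - k₀ + i, hidx i⟩) x ≤ 1 := fun v =>
    sum_smoothKernel_le_one μ k₀ _ hXmeas _ (hc _) hTc _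
  have h6 := linCost_le_klBits_add hkn1
    (quantVec (bits r n) (fun i : Fin n => X i ω) fun i => hXS i ω) (q n ω) (κ n ω) (hκ n ω)
    (fun v x => smoothKernel μ X k₀ (bits r n) (D * 2 ^ bits r n)
      (fun i : Fin k₀ => v ⟨k n - k₀ + i, hidx i⟩) x)
    (fun v x => smoothKernel_pos μ X k₀ _ (hc _) _ _) hQ1
  have h7 := h6.trans (add_le_add h3 h5)
  rw [← ENNReal.ofReal_add (by positivity) (by positivity)] at h7
  refine absurd hω (not_lt.2 (h7.trans (ENNReal.ofReal_le_ofReal (le_of_eq ?_))))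
  rw [he_def]
  ring

end SourceCost

/-! ### Probability bounds on the measured errors -/

section Measurements

variable {Ω : Type*} [MeasurableSpace Ω] {μ : Measure Ω} [IsProbabilityMeasure μ]
  {m n : ℕ} {a : Fin m × Fin n → Ω → ℝ} {Y : Ω → Fin n → ℝ}

theorem norm_toLp_mulVec_sub_sq (A : Matrix (Fin m) (Fin n) ℝ) (w x : Fin n → ℝ) :
    ‖WithLp.toLp 2 (A.mulVec w - A.mulVec x)‖ ^ 2 =
      ∑ i, (∑ j, A i j * (w j - x j)) ^ 2 := by
  rw [EuclideanSpace.real_norm_sq_eq, ← Matrix.mulVec_sub]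
  rfl

/-- The measured quantization error is unlikely to be much larger than its mean bound. -/
theorem measure_quantization_error_ge_le (ha : ∀ p, HasLaw (a p) (gaussianReal 0 1) μ)
    (hind : iIndepFun a μ) (hY : AEMeasurable Y μ) (hAY : IndepFun (fun ω p => a p ω) Y μ)
    (b : ℕ) (hm : 0 < m) (hn : 0 < n) {K : ℝ} (hK : 0 < K) :
    μ {ω | K * (m * n / ((2 : ℝ) ^ b) ^ 2) ≤
      ∑ i, (∑ j, a (i, j) ω * (quantize b (Y ω j) - Y ω j)) ^ 2} ≤ ENNReal.ofReal (1 / K) := by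
  have hmp : (0 : ℝ) < m := by exact_mod_cast hm
  have hnp : (0 : ℝ) < n := by exact_mod_cast hn
  set B : ℝ := m * n / ((2 : ℝ) ^ b) ^ 2 with hB
  have hB0 : 0 < B := by positivity
  have hav : AEMeasurable (fun ω p => a p ω) μ :=
    aemeasurable_pi_iff.2 fun p => (ha p).aemeasurable
  set g : (Fin m × Fin n → ℝ) → (Fin n → ℝ) → ℝ≥0∞ := fun z y =>
    ENNReal.ofReal (∑ i, (∑ j, z (i, j) * (quantize b (y j) - y j)) ^ 2) with hg
  have hgm : Measurable (Function.uncurry g) := by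
    have hq := measurable_quantize b
    simp only [hg, Function.uncurry_def]
    fun_prop
  have hmean : ∫⁻ ω, g (fun p => a p ω) (Y ω) ∂μ ≤ ENNReal.ofReal B := by
    refine lintegral_indep_le hav hY hAY hgm fun ω' => ?_
    simp only [hg]
    rw [lintegral_sum_sq ha hind]
    refine ENNReal.ofReal_le_ofReal ?_
    rw [hB, mul_div_assoc]
    gcongr
    calc ∑ j, (quantize b (Y ω' j) - Y ω' j) ^ 2 ≤ ∑ _j : Fin n, (1 / (2 : ℝ) ^ b) ^ 2 := by
          refine Finset.sum_le_sum fun j _ => ?_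
          rw [← neg_sq, neg_sub]
          have h1 := quantize_le b (Y ω' j)
          have h2 := sub_quantize_le b (Y ω' j)
          gcongr
      _ = _ := by
          simp [div_eq_mul_inv]
  have hmark := mul_meas_ge_le_lintegral₀ (μ := μ)
    (hgm.comp_aemeasurable (hav.prodMk hY)) (ENNReal.ofReal (K * B))
  have hKB : ENNReal.ofReal (K * B) ≠ 0 := (ENNReal.ofReal_pos.2 (by positivity)).ne'
  calc _ ≤ μ {ω | ENNReal.ofReal (K * B) ≤ g (fun p => a p ω) (Y ω)} :=
        measure_mono fun ω hω => ENNReal.ofReal_le_ofReal hω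
    _ ≤ ENNReal.ofReal B / ENNReal.ofReal (K * B) := by
        rw [ENNReal.le_div_iff_mul_le (Or.inl hKB) (Or.inl (by simp)), mul_comm]
        exact hmark.trans hmean
    _ = _ := by
        rw [← ENNReal.ofReal_div_of_pos (by positivity)]
        congr 1
        field_simp

/-- Uniform lower bound on the measured distance to finitely many candidates. -/
theorem measure_exists_sum_sq_le (ha : ∀ p, HasLaw (a p) (gaussianReal 0 1) μ)
    (hind : iIndepFun a μ) (hY : AEMeasurable Y μ) (hAY : IndepFun (fun ω p => a p ω) Y μ)
    {ι : Type*} (s : Set ι) (hs : s.Finite) (w : ι → Fin n → ℝ) {σ : ℝ} (hσ : 0 < σ) :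
    μ {ω | ∃ u ∈ s, 0 < ∑ j, (w u j - Y ω j) ^ 2 ∧
      ∑ i, (∑ j, a (i, j) ω * (w u j - Y ω j)) ^ 2 ≤ σ ^ 2 * m * ∑ j, (w u j - Y ω j) ^ 2} ≤
      ENNReal.ofReal (s.ncard * (Real.exp (1 / 2) * σ) ^ m) := by
  have hav : AEMeasurable (fun ω p => a p ω) μ :=
    aemeasurable_pi_iff.2 fun p => (ha p).aemeasurable
  -- Independence lets the signal be frozen at one value; the Gaussian tail then applies to the
  -- fixed difference vector, and if that vector vanishes the event is empty.
  have hone : ∀ u, μ {ω | 0 < ∑ j, (w u j - Y ω j) ^ 2 ∧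
      ∑ i, (∑ j, a (i, j) ω * (w u j - Y ω j)) ^ 2 ≤ σ ^ 2 * m * ∑ j, (w u j - Y ω j) ^ 2} ≤
      ENNReal.ofReal ((Real.exp (1 / 2) * σ) ^ m) := by
    intro u
    set E : Set ((Fin m × Fin n → ℝ) × (Fin n → ℝ)) := {z | 0 < ∑ j, (w u j - z.2 j) ^ 2 ∧
      ∑ i, (∑ j, z.1 (i, j) * (w u j - z.2 j)) ^ 2 ≤ σ ^ 2 * m * ∑ j, (w u j - z.2 j) ^ 2}
      with hE
    have hEm : MeasurableSet E :=
      (measurableSet_lt (f := fun _ => (0 : ℝ)) (g := fun z : (Fin m × Fin n → ℝ) × (Fin n → ℝ) =>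
          ∑ j, (w u j - z.2 j) ^ 2) (by fun_prop) (by fun_prop)).inter
        (measurableSet_le (f := fun z : (Fin m × Fin n → ℝ) × (Fin n → ℝ) =>
          ∑ i, (∑ j, z.1 (i, j) * (w u j - z.2 j)) ^ 2)
          (g := fun z => σ ^ 2 * m * ∑ j, (w u j - z.2 j) ^ 2) (by fun_prop) (by fun_prop))
    have hset : ∀ φ : Ω → (Fin m × Fin n → ℝ) × (Fin n → ℝ), AEMeasurable φ μ →
        ∫⁻ ω, E.indicator 1 (φ ω) ∂μ = μ (φ ⁻¹' E) := fun φ hφ => by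
      rw [← lintegral_indicator_one₀ (hφ.nullMeasurableSet_preimage hEm)]
      rfl
    have hbound : ∫⁻ ω, E.indicator 1 ((fun p => a p ω), Y ω) ∂μ ≤
        ENNReal.ofReal ((Real.exp (1 / 2) * σ) ^ m) := by
      refine lintegral_indep_le (g := fun z y => E.indicator 1 (z, y)) hav hY hAY
        (measurable_one.indicator hEm) fun ω' => ?_
      rw [hset (fun ω => ((fun p => a p ω), Y ω')) (hav.prodMk aemeasurable_const)]
      by_cases hv : 0 < ∑ j, (w u j - Y ω' j) ^ 2
      · rw [← ofReal_measureReal]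
        refine ENNReal.ofReal_le_ofReal ?_
        exact (measureReal_mono fun ω hω => hω.2).trans (measureReal_sum_sq_le ha hind hv hσ)
      · have : (fun ω => ((fun p => a p ω), Y ω')) ⁻¹' E = ∅ :=
          Set.eq_empty_of_forall_notMem fun ω hω => hv hω.1
        rw [this, measure_empty]
        exact zero_le
    rw [hset _ (hav.prodMk hY)] at hbound
    exact hbound
  calc _ ≤ μ (⋃ u ∈ hs.toFinset, {ω | 0 < ∑ j, (w u j - Y ω j) ^ 2 ∧
        ∑ i, (∑ j, a (i, j) ω * (w u j - Y ω j)) ^ 2 ≤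
          σ ^ 2 * m * ∑ j, (w u j - Y ω j) ^ 2}) := by
        refine measure_mono fun ω hω => ?_
        obtain ⟨u, hu, h⟩ := hω
        exact Set.mem_biUnion (hs.mem_toFinset.2 hu) h
    _ ≤ ∑ _u ∈ hs.toFinset, ENNReal.ofReal ((Real.exp (1 / 2) * σ) ^ m) :=
        (measure_biUnion_finset_le _ _).trans (Finset.sum_le_sum fun u _ => hone u)
    _ = _ := by
        rw [Finset.sum_const, nsmul_eq_mul, ← Set.ncard_eq_toFinset_card s hs,
          ENNReal.ofReal_mul (by positivity), ENNReal.ofReal_natCast]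

/-- A minimizer of the objective costs no more, and misfits no more, than the total objective of
any competitor. -/
theorem linCost_le_and_misfit_le_of_isMinOn {k : ℕ} {T : Set ℝ} {w : (Fin (k + 1) → T) → ℝ≥0∞}
    {lam : ℝ} {A : Matrix (Fin m) (Fin n) ℝ} {x : Fin n → ℝ} {u u₀ : Fin n → T}
    (hmin : IsMinOn (objective w lam A (A.mulVec x)) Set.univ u) {s t : ℝ} (hs : 0 ≤ s)
    (ht : 0 ≤ t) (hcost : linCost w u₀ ≤ ENNReal.ofReal s)
    (hfit : lam / (n : ℝ) ^ 2 * ∑ i, (∑ j, A i j * (u₀ j - x j)) ^ 2 ≤ t) :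
    linCost w u ≤ ENNReal.ofReal (s + t) ∧
      lam / (n : ℝ) ^ 2 * ∑ i, (∑ j, A i j * (u j - x j)) ^ 2 ≤ s + t := by
  have h := hmin (Set.mem_univ u₀)
  simp only [Set.mem_ofPred_eq, objective, norm_toLp_mulVec_sub_sq] at h
  have h' := h.trans (add_le_add hcost (ENNReal.ofReal_le_ofReal hfit))
  rw [← ENNReal.ofReal_add hs ht] at h'
  exact ⟨le_self_add.trans h', (ENNReal.ofReal_le_ofReal_iff (by positivity)).1
    (le_add_self.trans h')⟩

end Measurements

/-! ### Balancing the exponents -/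

section Estimates

theorem exp_half_le_two : Real.exp (1 / 2) ≤ 2 := by
  have h : Real.exp (1 / 2) * Real.exp (1 / 2) = Real.exp 1 := by
    rw [← Real.exp_add]; norm_num
  nlinarith [Real.exp_one_lt_d9, Real.exp_pos (1 / 2)]

/-- The union bound over the cheap sequences beats the Gaussian lower tail. -/
theorem ncard_cheapSet_mul_le {α : Type*} [Fintype α] {n k m b : ℕ} (hn : k + 1 < n)
    {L γ : ℝ} (hL : 0 ≤ L) (hcount : ∀ M : ℕ, (M : ℝ) ≤ √(n : ℝ) →
      ((n : ℝ) + 1) ^ M * M ≤ 2 ^ (m : ℝ)) (hcard : (Fintype.card α : ℝ) ^ (k + 1) ≤ √(n : ℝ))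
    (hLm : n * L ≤ b * m * (1 - 3 * γ / 4)) (hb : 12 ≤ b * γ) :
    ((cheapSet n k α L).ncard : ℝ) *
      (Real.exp (1 / 2) * (2 : ℝ) ^ (-(b * (1 - γ / 2)))) ^ m ≤ (1 / 2) ^ m := by
  have h1 := ncard_cheapSet_le (α := α) hn hL
  have h2 := hcount (Fintype.card α ^ (k + 1)) (by exact_mod_cast hcard)
  push_cast at h2
  have h3 : ((cheapSet n k α L).ncard : ℝ) ≤ 2 ^ (m : ℝ) * 2 ^ (b * m * (1 - 3 * γ / 4)) := by
    refine h1.trans ?_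
    rw [← mul_assoc]
    gcongr
    exact one_le_two
  have h4 : (Real.exp (1 / 2) * (2 : ℝ) ^ (-(b * (1 - γ / 2)))) ^ m ≤
      2 ^ (m * (1 - b * (1 - γ / 2))) := by
    calc _ ≤ (2 * (2 : ℝ) ^ (-(b * (1 - γ / 2)))) ^ m := by
          gcongr
          exact exp_half_le_two
      _ = ((2 : ℝ) ^ (1 - b * (1 - γ / 2))) ^ m := by
          rw [sub_eq_add_neg (1 : ℝ) (b * _), Real.rpow_add two_pos, Real.rpow_one]
      _ = _ := by
          rw [← Real.rpow_natCast, ← Real.rpow_mul two_pos.le, mul_comm]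
  calc _ ≤ (2 ^ (m : ℝ) * 2 ^ (b * m * (1 - 3 * γ / 4))) *
        (2 : ℝ) ^ (m * (1 - b * (1 - γ / 2))) := by
        gcongr
    -- The exponent collects `1` from the tables of counts, `1` from `e^{1/2} ≤ 2`, and `-b γ / 4`
    -- from the gap between `3γ/4` and `γ/2`; `b γ ≥ 12` makes it at most `-1`.
    _ = 2 ^ (m * (2 - b * γ / 4)) := by
        rw [← Real.rpow_add two_pos, ← Real.rpow_add two_pos]
        congr 1
        ring
    _ ≤ 2 ^ (m * (-1 : ℝ)) := by
        gcongr
        · exact one_le_two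
        · linarith
    _ = _ := by
        rw [mul_neg_one, Real.rpow_neg two_pos.le, Real.rpow_natCast, one_div, inv_pow]

/-- Dividing the misfit bound by `lam * σ² * m` leaves the factor `2 ^ (-2 b) * 2 ^ (2 b (1 - γ/2))
= 2 ^ (-γ b)`: half of the rate gap survives as decay. -/
theorem div_le_of_misfit_le {n m b : ℕ} (hn : 0 < n) (hm : 0 < m) {lam L F V θ γ : ℝ}
    (hlam : ((2 : ℝ) ^ b) ^ 2 ≤ lam) (hF : lam / (n : ℝ) ^ 2 * F ≤ L) (hL : n * L ≤ b * m * θ)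
    (hθ : θ ≤ 1) (hV : 0 ≤ V)
    (hVF : ((2 : ℝ) ^ (-(b * (1 - γ / 2)))) ^ 2 * m * V ≤ F) :
    V / n ≤ b * ((2 : ℝ) ^ (-γ)) ^ b := by
  have hnp : (0 : ℝ) < n := by exact_mod_cast hn
  have hmp : (0 : ℝ) < m := by exact_mod_cast hm
  have hl0 : 0 < lam := lt_of_lt_of_le (by positivity) hlam
  set τ : ℝ := ((2 : ℝ) ^ (-(b * (1 - γ / 2)))) ^ 2 with hτ
  have hτ0 : 0 < τ := by positivity
  have hpow : ((2 : ℝ) ^ b) ^ 2 * τ * ((2 : ℝ) ^ (-γ)) ^ b = 1 := by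
    rw [hτ, ← Real.rpow_natCast, ← Real.rpow_natCast, ← Real.rpow_natCast, ← Real.rpow_natCast,
      ← Real.rpow_mul two_pos.le, ← Real.rpow_mul two_pos.le, ← Real.rpow_mul two_pos.le,
      ← Real.rpow_add two_pos, ← Real.rpow_add two_pos]
    convert Real.rpow_zero (2 : ℝ) using 2
    push_cast
    ring
  set ζ : ℝ := ((2 : ℝ) ^ (-γ)) ^ b with hζ
  have hζ0 : 0 < ζ := by positivity
  have h1 : lam * F ≤ L * n ^ 2 := by
    rwa [div_mul_eq_mul_div, div_le_iff₀ (by positivity)] at hF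
  have h2 : ((2 : ℝ) ^ b) ^ 2 * (τ * m * V) ≤ lam * F :=
    mul_le_mul hlam hVF (by positivity) hl0.le
  have h3 : L * (n : ℝ) ^ 2 ≤ b * m * n := by
    have : b * m * θ ≤ b * m := mul_le_of_le_one_right (by positivity) hθ
    nlinarith
  have h4 : m * (((2 : ℝ) ^ b) ^ 2 * τ * V) ≤ m * (b * n) := by linarith
  have h5 := le_of_mul_le_mul_left h4 hmp
  have h6 := mul_le_mul_of_nonneg_left h5 hζ0.le
  rw [div_le_iff₀ hnp]
  have h7 : ζ * (((2 : ℝ) ^ b) ^ 2 * τ * V) = V := by linear_combination V * hpow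
  linarith

end Estimates

theorem IsCondProb.tsum_le_one {α : Type*} {k : ℕ} {q : PMF (Fin (k + 1) → α)}
    {κ : (Fin k → α) → α → ℝ≥0∞} (h : IsCondProb q κ) (v : Fin k → α) : ∑' x, κ v x ≤ 1 := by
  by_cases hv : marginal q v = 0
  · exact h.2 v hv
  · simp_rw [h.1 v _ hv, div_eq_mul_inv]
    rw [ENNReal.tsum_mul_right]
    exact ENNReal.mul_inv_le_one _

end AMEP

theorem mainTheorem5
    {Ω : Type*} [MeasurableSpace Ω] (μ : Measure Ω) [IsProbabilityMeasure μ]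
    -- the source: a stationary `Ψ*`-mixing process with a bounded alphabet `S`
    (S : Set ℝ) (hS : Bornology.IsBounded S)
    (X : ℕ → Ω → ℝ) (hXmeas : ∀ i, Measurable (X i)) (hXS : ∀ i ω, X i ω ∈ S)
    (hstat : AMEP.IsStationary μ X) (hmix : AMEP.IsPsiStarMixing μ X)
    (d : ℝ≥0) (hd : AMEP.IsUpperInfoDim μ X d)
    -- the parameters
    (r δ c : ℝ) (hr : 1 < r) (hδ : 0 < δ) (hc : 0 < c)
    (m : ℕ → ℕ) (hm : ∀ n : ℕ, (1 + δ) * (d : ℝ) * n ≤ m n) (hmc : ∀ n : ℕ, c * n ≤ m n)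
    (k : ℕ → ℕ) (hk : Tendsto k atTop atTop)
    (hko : (fun n : ℕ => (k n : ℝ)) =o[atTop]
      fun n : ℕ => Real.logb 2 n / Real.logb 2 (Real.logb 2 n))
    -- the sensing matrices: i.i.d. standard normal entries, independent of the signal
    (A : ∀ n : ℕ, Ω → Matrix (Fin (m n)) (Fin n) ℝ)
    (hAlaw : ∀ n i j, HasLaw (fun ω => A n ω i j) (gaussianReal 0 1) μ)
    (hAindep : ∀ n, iIndepFun (fun (p : Fin (m n) × Fin n) ω => A n ω p.1 p.2) μ)
    (hAX : ∀ n, IndepFun (fun ω (p : Fin (m n) × Fin n) => A n ω p.1 p.2)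
      (fun ω (i : Fin n) => X i ω) μ)
    -- the learned distributions, their conditional distributions and the weights
    (q : ∀ n : ℕ, Ω → PMF (Fin (k n + 1) → AMEP.quantSet (AMEP.bits r n) S))
    (κ : ∀ n : ℕ, Ω → (Fin (k n) → AMEP.quantSet (AMEP.bits r n) S) →
      AMEP.quantSet (AMEP.bits r n) S → ℝ≥0∞)
    (hκ : ∀ n ω, AMEP.IsCondProb (q n ω) (κ n ω))
    (W : ∀ n : ℕ, Ω → (Fin (k n + 1) → AMEP.quantSet (AMEP.bits r n) S) → ℝ≥0∞)
    (hW : ∀ n ω a, W n ω a = AMEP.negLogTwo (κ n ω (Fin.init a) (a (Fin.last (k n)))))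
    (hKL : ∀ ε : ℝ, 0 < ε → Tendsto (fun n : ℕ => μ {ω | ENNReal.ofReal ε <
      AMEP.klBits (AMEP.quantVec (AMEP.bits r n) (fun i : Fin n => X i ω) (fun i => hXS i ω))
        (q n ω) / (AMEP.bits r n : ℝ≥0∞)}) atTop (𝓝 0))
    -- the reconstruction: any minimizer of the objective with measurements `Y = A X`
    (Xhat : ∀ n : ℕ, Ω → Fin n → AMEP.quantSet (AMEP.bits r n) S)
    (hXhat : ∀ n ω, IsMinOn (AMEP.objective (W n ω) (AMEP.regParam r n) (A n ω)
      ((A n ω).mulVec fun i : Fin n => X i ω)) Set.univ (Xhat n ω)) :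
    TendstoInMeasure μ
      (fun (n : ℕ) ω => 1 / Real.sqrt n *
        ‖WithLp.toLp 2 (fun i : Fin n => X i ω - (Xhat n ω i : ℝ))‖)
      atTop (fun _ => (0 : ℝ)) := by
  classical
  have hr0 : 0 < r := by linarith
  obtain ⟨D, hD, hcard⟩ := AMEP.exists_ncard_quantSet_le hS
  have hkn := AMEP.eventually_succ_le_half hr0 hD hko
  have hd0 : (0 : ℝ) ≤ d := d.2
  -- A sampling rate strictly above `d`: if `d = 0` the multiplicative margin gives nothing, and `c`
  -- takes its place.
  obtain ⟨ρ, hρd, hρm⟩ : ∃ ρ : ℝ, (d : ℝ) < ρ ∧ ∀ n, ρ * n ≤ m n := by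
    rcases hd0.eq_or_lt with h | h
    · exact ⟨c, h ▸ hc, hmc⟩
    · exact ⟨(1 + δ) * d, by nlinarith, hm⟩
  have hρ0 : 0 < ρ := hd0.trans_lt hρd
  set d' : ℝ := (d + ρ) / 2 with hd'_def
  have hd' : (d : ℝ) < d' := by linarith
  have hd'ρ : d' < ρ := by linarith
  have hd'0 : 0 < d' := hd0.trans_lt hd'
  -- The relative slack between the code rate `d'` and the sampling rate `ρ`; every later margin is
  -- a fraction of it.
  set γ : ℝ := 1 - d' / ρ with hγ_def
  have hγ0 : 0 < γ := by
    rw [hγ_def, sub_pos, div_lt_one hρ0]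
    exact hd'ρ
  have hγρ : d' = (1 - γ) * ρ := by
    rw [hγ_def]; field_simp; ring
  have hb_top := AMEP.tendsto_bits hr0
  have hb_top' : Tendsto (fun n => (AMEP.bits r n : ℝ)) atTop atTop :=
    tendsto_natCast_atTop_atTop.comp hb_top
  have hm_top : Tendsto m atTop atTop := by
    rw [← tendsto_natCast_atTop_iff (R := ℝ)]
    exact tendsto_atTop_mono hρm (tendsto_natCast_atTop_atTop.const_mul_atTop hρ0)
  have hcost := AMEP.tendsto_measure_linCost_quantVec μ hS hXmeas hXS hstat hmix hd hr0 hk hkn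
    q κ hκ hKL hd'
  have hnoise : Tendsto (fun n => ENNReal.ofReal (1 / (γ / 16 * AMEP.bits r n))) atTop (𝓝 0) := by
    have h := (hb_top'.const_mul_atTop (by positivity : 0 < γ / 16)).const_div_atTop 1
    simpa using ENNReal.tendsto_ofReal h
  have hunion : Tendsto (fun n => ENNReal.ofReal ((1 / 2) ^ m n)) atTop (𝓝 0) := by
    have h := (tendsto_pow_atTop_nhds_zero_of_lt_one (r := (1 / 2 : ℝ)) (by norm_num)
      (by norm_num)).comp hm_top
    simpa using ENNReal.tendsto_ofReal h
  have hsmall : Tendsto (fun n => (AMEP.bits r n : ℝ) * ((2 : ℝ) ^ (-γ)) ^ AMEP.bits r n)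
      atTop (𝓝 0) :=
    (tendsto_self_mul_const_pow_of_lt_one (by positivity)
      (Real.rpow_lt_one_of_one_lt_of_neg one_lt_two (by linarith))).comp hb_top
  rw [tendstoInMeasure_iff_norm]
  intro ε hε
  refine tendsto_of_tendsto_of_tendsto_of_le_of_le' tendsto_const_nhds
    (by simpa only [add_zero] using (hcost.add hnoise).add hunion)
    (Eventually.of_forall fun _ => zero_le) ?_
  filter_upwards [hkn, hb_top'.eventually_ge_atTop (12 / γ), AMEP.eventually_two_pow_bits hr0,
    AMEP.eventually_alphabet_pow_le hr0 hD hko, AMEP.eventually_pow_mul_le hc,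
    hm_top.eventually_gt_atTop 0, hsmall.eventually_lt_const (show 0 < ε ^ 2 by positivity)]
    with n hn hbγ hlam hpow hcount hm0 hfinal
  have hn0 : 0 < n := by omega
  have hnp : (0 : ℝ) < n := by exact_mod_cast hn0
  have hmp : (0 : ℝ) < m n := by exact_mod_cast hm0
  rw [div_le_iff₀ hγ0] at hbγ
  set b := AMEP.bits r n with hb_def
  have hbp : (0 : ℝ) < b := by
    rcases (Nat.cast_nonneg b : (0 : ℝ) ≤ b).eq_or_lt with h | h
    · rw [← h] at hbγ; linarith
    · exact h
  have hfin := (hcard b).1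
  have := hfin.fintype
  -- Misfit budget of the quantized source: Markov's factor `γ b / 16` times the `4` from `regParam
  -- r n ≤ 4 * (2 ^ b) ^ 2`. The failure probability `16 / (γ b)` tends to `0`.
  set t : ℝ := γ / 4 * b * m n / n with ht_def
  have ht0 : 0 ≤ t := by positivity
  set L : ℝ := b * d' + t with hL_def
  have hL0 : 0 ≤ L := by positivity
  have hLm : n * L ≤ b * m n * (1 - 3 * γ / 4) := by
    have h1 : n * t = γ / 4 * b * m n := by
      rw [ht_def]; field_simp
    have h2 : b * ((1 - γ) * (ρ * n)) ≤ b * ((1 - γ) * m n) := by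
      have : 0 ≤ 1 - γ := by
        rw [hγ_def, sub_sub_cancel]; positivity
      gcongr
      exact hρm n
    rw [hL_def, mul_add, h1, hγρ]
    linarith
  set σ : ℝ := (2 : ℝ) ^ (-(b * (1 - γ / 2))) with hσ_def
  have hYm : AEMeasurable (fun ω (i : Fin n) => X i ω) μ :=
    aemeasurable_pi_iff.2 fun i => (hXmeas i).aemeasurable
  have hE3 := AMEP.measure_quantization_error_ge_le (a := fun p ω => A n ω p.1 p.2)
    (fun p => hAlaw n p.1 p.2) (hAindep n) hYm (hAX n) b hm0 hn0
    (K := γ / 16 * b) (by positivity)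
  have hE4 := AMEP.measure_exists_sum_sq_le (a := fun p ω => A n ω p.1 p.2)
    (fun p => hAlaw n p.1 p.2) (hAindep n) hYm (hAX n)
    (AMEP.cheapSet n (k n) (AMEP.quantSet b S) L) (Set.toFinite _)
    (fun u j => (u j : ℝ)) (σ := σ) (by positivity)
  have hTcard : (Fintype.card (AMEP.quantSet b S) : ℝ) ^ (k n + 1) ≤ √(n : ℝ) := by
    refine le_trans ?_ hpow
    gcongr
    rw [← Nat.card_eq_fintype_card, Nat.card_coe_set_eq]
    exact (hcard b).2
  have hbad := AMEP.ncard_cheapSet_mul_le (α := AMEP.quantSet b S) (n := n) (k := k n) (m := m n)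
    (b := b) (γ := γ) (by omega) hL0
    (fun M hM => (hcount M hM).trans (Real.rpow_le_rpow_of_exponent_le one_le_two (hmc n)))
    hTcard hLm hbγ
  refine le_trans ?_ (add_le_add (add_le_add le_rfl hE3)
    (hE4.trans (ENNReal.ofReal_le_ofReal hbad)))
  refine (measure_mono fun ω hω => ?_).trans
    ((measure_union_le _ _).trans (add_le_add_left (measure_union_le _ _) _))
  by_contra hcon
  simp only [Set.mem_union, Set.mem_ofPred_eq, not_or, not_lt, not_le, not_exists,
    not_and] at hcon hω
  obtain ⟨⟨hC, hE⟩, hU⟩ := hcon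
  have hWκ : W n ω = fun a => AMEP.negLogTwo (κ n ω (Fin.init a) (a (Fin.last (k n)))) :=
    funext (hW n ω)
  have hfit : AMEP.regParam r n / (n : ℝ) ^ 2 * ∑ i, (∑ j, A n ω i j *
      ((AMEP.quantVec b (fun i : Fin n => X i ω) (fun i => hXS i ω) j : ℝ) - X j ω)) ^ 2 ≤ t := by
    have hl0 : 0 ≤ AMEP.regParam r n := le_trans (by positivity) hlam.2.1
    calc _ ≤ 4 * ((2 : ℝ) ^ b) ^ 2 / (n : ℝ) ^ 2 *
          (γ / 16 * b * (m n * n / ((2 : ℝ) ^ b) ^ 2)) := by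
          gcongr
          · exact hlam.2.2
          · exact hE.le
      _ = t := by
          rw [ht_def]; field_simp; ring
  obtain ⟨h1, h2⟩ := AMEP.linCost_le_and_misfit_le_of_isMinOn (hXhat n ω) (by positivity) ht0
    (hWκ ▸ hC) hfit
  -- The kernel here is random, which is harmless because membership in the cheap set only asks for
  -- the existence of some kernel.
  have hcheap : Xhat n ω ∈ AMEP.cheapSet n (k n) (AMEP.quantSet b S) L := by
    refine ⟨κ n ω, fun v => ?_, hWκ ▸ h1⟩
    exact AMEP.IsCondProb.tsum_le_one (hκ n ω) v
  have hVF : σ ^ 2 * m n * ∑ j, ((Xhat n ω j : ℝ) - X j ω) ^ 2 ≤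
      ∑ i, (∑ j, A n ω i j * ((Xhat n ω j : ℝ) - X j ω)) ^ 2 := by
    -- The separation event excludes a zero difference, where the inequality is trivial.
    rcases (Finset.sum_nonneg fun (j : Fin n) _ =>
      sq_nonneg ((Xhat n ω j : ℝ) - X j ω)).eq_or_lt with h | h
    · rw [← h, mul_zero]
      positivity
    · exact (hU _ hcheap h).le
  have hV := AMEP.div_le_of_misfit_le hn0 hm0 hlam.2.1 h2 hLm (by linarith) (by positivity) hVF
  have hnorm : (1 / √(n : ℝ) * ‖WithLp.toLp 2 (fun i : Fin n => X i ω - (Xhat n ω i : ℝ))‖) ^ 2 =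
      (∑ j, ((Xhat n ω j : ℝ) - X j ω) ^ 2) / n := by
    rw [mul_pow, div_pow, Real.sq_sqrt hnp.le, EuclideanSpace.real_norm_sq_eq, one_pow,
      one_div_mul_eq_div]
    congr 1
    exact Finset.sum_congr rfl fun j _ => by ring
  rw [sub_zero, Real.norm_of_nonneg (by positivity)] at hω
  have h3 : ε ^ 2 ≤ (∑ j, ((Xhat n ω j : ℝ) - X j ω) ^ 2) / n :=
    hnorm ▸ pow_le_pow_left₀ hε.le hω 2
  linarith
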